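/- Let $T=(V,E,F)$ be a triangulated plane, i.e. a (locally finite) simplicial complex consisting of vertices, edges and triangles whose underlying space $|T|$ is homeomorphic to the plane. A \emph{geodesic embedding} is a map $\phi:|T|\to\mathbb{C}$ that is a homeomorphism onto its image and maps every edge $ij\in E$ to the straight segment connecting $\phi(i)$ and $\phi(j)$; it induces the PL metric $l_{ij}=|\phi(i)-\phi(j)|$ on $E$. For a PL metric $l$ and a triangle $ijk\in F$, let $\theta^i_{jk}$ be the angle at $i$ of the Euclidean triangle with side lengths $l_{ij},l_{jk},l_{ki}$. The metric $l$ is \emph{uniformly nondegenerate with constant $\epsilon$} if $\theta^i_{jk}\ge\epsilon$ for every triangle $ijk\in F$ and each of its vertices $i$, and \emph{Delaunay} if $\theta^k_{ij}+\theta^m_{ij}\le\pi$ for any two distinct triangles $kij,\,mij\in F$ sharing an edge $ij$. For $u:V\to\mathbb{R}$ write $l'=u*l$ if $l'_{ij}=e^{(u_i+u_j)/2}\,l_{ij}$ for all $ij\in E$. Let $D_\rho=\{z\in\mathbb{C}:|z|<\rho\}$. For every $\epsilon>0$ there is a constant $M=M(\epsilon)>0$, depending only on $\epsilon$, with the following property.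 Let $T$ be a triangulated plane, and let $\phi,\phi':|T|\to\mathbb{C}$ be geodesic embeddings whose induced PL metrics $l,l'$ are both uniformly nondegenerate with constant $\epsilon$ and Delaunay. Suppose $l'=u*l$ for some $u:V\to\mathbb{R}$. Let $r,r'>0$ and let $T_0$ be a subcomplex of $T$ with $$\phi(|T_0|)\subset D_r,\qquad D_{r'}\subset\phi'(|T_0|).$$ Then for every vertex $i$ of $T_0$ with $\phi'(i)\in D_{r'/2}$, $$u_i\ \ge\ \log\frac{r'}{r}-M.$$ -/

import Mathlib

namespace TriPlane

/-- The underlying space `|K|` of a simplicial complex `K` in barycentric coordinates: the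
functions `x : V → ℝ` that are nonnegative, vanish off some simplex of `K`, and have total mass 1.
It carries the subspace topology of the product `V → ℝ`; for a locally finite complex (the only
complexes used below) this is the usual weak topology. -/
def realization {V : Type*} (K : PreAbstractSimplicialComplex V) : Set (V → ℝ) :=
  {x | ∃ s ∈ K.faces, (∀ i, 0 ≤ x i) ∧ (∀ i, i ∉ s → x i = 0) ∧ ∑ i ∈ s, x i = 1}

/-- The underlying space `|T|` as a topological space. -/
abbrev Space {V : Type*} (T : AbstractSimplicialComplex V) : Type _ :=
  realization T.toPreAbstractSimplicialComplex

/-- The underlying space of `K`, as a subset of `|T|` (used for subcomplexes `K` of `T`). -/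
def carrier {V : Type*} (T : AbstractSimplicialComplex V) (K : PreAbstractSimplicialComplex V) :
    Set (Space T) :=
  {x | (x : V → ℝ) ∈ realization K}

/-- `T` is a triangulation of the plane: a locally finite complex whose simplices are vertices,
edges and triangles, and whose underlying space is homeomorphic to the plane. -/
structure IsTriangulatedPlane {V : Type*} (T : AbstractSimplicialComplex V) : Prop where
  locallyFinite : ∀ i : V, {s ∈ T.faces | i ∈ s}.Finite
  card_le : ∀ s ∈ T.faces, s.card ≤ 3
  homeo : Nonempty (Space T ≃ₜ ℂ)

section

variable {V : Type*} [DecidableEq V] (T : AbstractSimplicialComplex V)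

/-- `ij ∈ E`. -/
def IsEdge (i j : V) : Prop :=
  i ≠ j ∧ {i, j} ∈ T.faces

/-- `ijk ∈ F`. -/
def IsTriangle (i j k : V) : Prop :=
  i ≠ j ∧ j ≠ k ∧ i ≠ k ∧ {i, j, k} ∈ T.faces

/-- The point of `|T|` given by the vertex `i`. -/
def vertex (i : V) : Space T :=
  ⟨Pi.single i 1, {i}, T.singleton_mem i,
    fun j => by
      by_cases h : j = i
      · subst h; simp
      · simp [h],
    fun j hj => by
      have h : j ≠ i := by simpa using hj
      simp [h],
    by simp⟩

/-- The closed edge `ij` as a subset of `|T|`: the points supported on `{i, j}`. -/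
def edgeSet (i j : V) : Set (Space T) :=
  {x | ∀ k, k ≠ i → k ≠ j → (x : V → ℝ) k = 0}

/-- A geodesic embedding `φ : |T| → ℂ`: a homeomorphism onto its image that maps every edge `ij`
to the segment connecting `φ(i)` and `φ(j)`. -/
structure IsGeodesicEmbedding (φ : Space T → ℂ) : Prop where
  isEmbedding : Topology.IsEmbedding φ
  image_edge : ∀ i j, IsEdge T i j →
    φ '' edgeSet T i j = segment ℝ (φ (vertex T i)) (φ (vertex T j))

/-- The edge lengths `l(φ)` induced by a geodesic embedding. -/
noncomputable def inducedMetric (φ : Space T → ℂ) (i j : V) : ℝ :=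
  dist (φ (vertex T i)) (φ (vertex T j))

/-- The angle `θ^i_{jk}` at `i` of the Euclidean triangle `ijk` with side lengths `l`
(law of cosines). -/
noncomputable def cornerAngle (l : V → V → ℝ) (i j k : V) : ℝ :=
  Real.arccos ((l i j ^ 2 + l i k ^ 2 - l j k ^ 2) / (2 * l i j * l i k))

/-- `l` is uniformly nondegenerate with constant `ε`: all angles are at least `ε`. -/
def UniformlyNondegenerate (l : V → V → ℝ) (ε : ℝ) : Prop :=
  ∀ i j k, IsTriangle T i j k → ε ≤ cornerAngle l i j k

/-- `l` is Delaunay: `θ^k_{ij} + θ^m_{ij} ≤ π` for any two triangles `kij`, `mij` sharing the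
edge `ij`. -/
def Delaunay (l : V → V → ℝ) : Prop :=
  ∀ i j k m, IsTriangle T k i j → IsTriangle T m i j → k ≠ m →
    cornerAngle l k i j + cornerAngle l m i j ≤ Real.pi

/-- `l' = u * l`: the metric `l'` is discrete conformal to `l` with conformal factor `u`. -/
def DiscreteConformal (u : V → ℝ) (l l' : V → V → ℝ) : Prop :=
  ∀ i j, IsEdge T i j → l' i j = Real.exp ((u i + u j) / 2) * l i j

end

end TriPlane

namespace TriPlane

/-! The proof is a discrete Schwarz–Pick argument. With R = K r and ρ = 3r'/4, the quantity e^{u_i}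
(R² - |φ(i)|²) / (ρ² - |φ'(i)|²), called `hypFactor`, compares the hyperbolic metrics of D_R and
D_ρ. A lower bound by a constant times r/ρ suffices: on D_{r'/2} the denominator is comparable to
r'², and R² - |φ(i)|² ≤ R². Over the finitely many vertices mapped by φ' into D_ρ the factor attains
its minimum at some k. If an edge at k is long compared with ρ - |φ'(k)|, the law of sines bounds
e^{u_k} from below (`sin_sq_mul_le_exp`). Otherwise all neighbours of k stay in D_ρ, and a minimum
principle (`le_hypFactor_of_forall_le`) gives the bound R/ρ.

The minimum principle concerns a single star. Invert at the centre: neighbours h_j become 1/h_j, and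
|1/a - 1/b| = |a - b| / (|a||b|), so by discrete conformality the star of φ', and that of φ scaled
by e^{u_k}, give polygons with the same side lengths. The Delaunay condition says that these
polygons are convex at each vertex. If all distances from a base point were strictly larger in one
polygon than in the other, its total angle at the base point would be strictly smaller
(`sum_apexAngle_lt`), whereas it is at least 2π in the first and at most 2π in the second
(`IsStar.exists_norm_le`). The base points used are the inverted mirror images of the centre in the
circles |z| = R and |z| = ρ; the Möbius identity `norm_one_sub_sq` then turns the comparison into
one between values of `hypFactor`. Uniform nondegeneracy keeps a base point on the correct side of
every polygon side as long as the star is small.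

The remaining input is topological, since a geodesic embedding is only prescribed on edges. A
winding argument and connectedness show that open triangles are mapped into open Euclidean triangles
(`map_interior`). Hence sectors at a vertex are disjoint, and near interior points of the image each
edge has a triangle on both sides. This yields the cyclic order of a star from φ'; for φ only the
combinatorial order is used, because its total angle is a positive multiple of 2π. -/

/-! ### Winding argument for maps of a triangle into the plane -/

/-- The oriented area `Im (conj a * b)` of the parallelogram spanned by `a` and `b`. -/
def cross (a b : ℂ) : ℝ := a.re * b.im - a.im * b.re

/-- The domain is simply connected, so F/‖F‖ lifts through the covering `Circle.exp`. -/
lemma exists_continuous_angle {F : ℝ × ℝ → ℂ} (hF : Continuous F) (h0 : ∀ x, F x ≠ 0) :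
    ∃ g : ℝ × ℝ → ℝ, Continuous g ∧ ∀ x, F x = ‖F x‖ * Complex.exp (g x * Complex.I) := by
  have hn : ∀ x, F x / ‖F x‖ ∈ Submonoid.unitSphere ℂ := by
    intro x
    rw [Submonoid.unitSphere, Submonoid.mem_mk, Subsemigroup.mem_mk, mem_sphere_zero_iff_norm, norm_div, Complex.norm_real, norm_norm,
      div_self (norm_ne_zero_iff.2 (h0 x))]
  let G : C(ℝ × ℝ, Circle) := ⟨fun x => ⟨F x / ‖F x‖, hn x⟩, by
    refine Continuous.subtype_mk ?_ _
    refine hF.div (by fun_prop) fun x => ?_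
    simpa using h0 x⟩
  obtain ⟨e₀, he₀⟩ := Circle.exp_surjective (G (0, 0))
  obtain ⟨g, ⟨-, hg⟩, -⟩ :=
    Circle.isCoveringMap_exp.existsUnique_continuousMap_lifts G (0, 0) e₀ he₀
  refine ⟨g, g.continuous, fun x => ?_⟩
  have h1 : Circle.exp (g x) = G x := congrFun hg x
  have h2 : ((Circle.exp (g x) : Circle) : ℂ) = F x / ‖F x‖ := by rw [h1]; rfl
  rw [Circle.coe_exp] at h2
  rw [h2, mul_div_cancel₀]
  simpa using h0 x

/-- If h 1 were nonpositive, the positive sine would push it below -π, and the path would have to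
cross -π. -/
lemma angle_pos_of_sin_pos {h : ℝ → ℝ} (hc : ContinuousOn h (Set.Icc 0 1)) (h0 : h 0 = 0)
    (hpi : ∀ t ∈ Set.Icc (0 : ℝ) 1, h t ≠ -Real.pi) (h1 : 0 < Real.sin (h 1)) : 0 < h 1 := by
  by_contra hle
  push Not at hle
  have h2 : h 1 < -Real.pi := by
    by_contra h3
    push Not at h3
    have := Real.sin_nonpos_of_nonpos_of_neg_pi_le hle h3
    linarith
  obtain ⟨t, ht, hte⟩ := intermediate_value_Icc' (zero_le_one) hc
    ⟨h2.le, by rw [h0]; linarith [Real.pi_pos]⟩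
  exact hpi t ht hte

/-- A point moving within a segment that ends to the left of its initial direction never points
opposite to that direction, so its angle gain cannot pass through -π. -/
lemma angle_increases {F : ℝ × ℝ → ℂ} {g : ℝ × ℝ → ℝ} (h0 : ∀ x, F x ≠ 0) (hg : Continuous g)
    (hFg : ∀ x, F x = ‖F x‖ * Complex.exp (g x * Complex.I))
    {γ : ℝ → ℝ × ℝ} (hγ : Continuous γ)
    (hcr : 0 < cross (F (γ 0)) (F (γ 1)))
    (hseg : ∀ t ∈ Set.Icc (0 : ℝ) 1, F (γ t) ∈ segment ℝ (F (γ 0)) (F (γ 1))) :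
    g (γ 0) < g (γ 1) := by
  have hre : ∀ x, (F x).re = ‖F x‖ * Real.cos (g x) := fun x => by
    have := congrArg Complex.re (hFg x)
    rwa [Complex.re_ofReal_mul, Complex.exp_ofReal_mul_I_re] at this
  have him : ∀ x, (F x).im = ‖F x‖ * Real.sin (g x) := fun x => by
    have := congrArg Complex.im (hFg x)
    rwa [Complex.im_ofReal_mul, Complex.exp_ofReal_mul_I_im] at this
  have key : ∀ x y, cross (F x) (F y) = ‖F x‖ * ‖F y‖ * Real.sin (g y - g x) := fun x y => by
    rw [cross, hre, him, hre, him, Real.sin_sub]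
    ring
  have key2 : ∀ x y, (F x).re * (F y).re + (F x).im * (F y).im
      = ‖F x‖ * ‖F y‖ * Real.cos (g y - g x) := fun x y => by
    rw [hre, him, hre, him, Real.cos_sub]
    ring
  have hnp : ∀ x y, 0 < ‖F x‖ * ‖F y‖ := fun x y =>
    mul_pos (norm_pos_iff.2 (h0 x)) (norm_pos_iff.2 (h0 y))
  have := angle_pos_of_sin_pos (h := fun t => g (γ t) - g (γ 0)) (by fun_prop) (by simp) ?_ ?_
  · simpa using this
  · intro t ht hpi
    obtain ⟨a, b, ha, hb, hab, he⟩ := hseg t ht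
    have k1 := key (γ 0) (γ t)
    have k2 := key2 (γ 0) (γ t)
    rw [hpi] at k1 k2
    simp only [Real.sin_neg, Real.sin_pi, neg_zero, mul_zero, Real.cos_neg, Real.cos_pi] at k1 k2
    have hre : (F (γ t)).re = a * (F (γ 0)).re + b * (F (γ 1)).re := by rw [← he]; simp
    have him : (F (γ t)).im = a * (F (γ 0)).im + b * (F (γ 1)).im := by rw [← he]; simp
    -- A direction opposite to the initial one has zero cross product with it; on this segment that
    -- happens only at the initial endpoint, which is not opposite to itself.
    have hb0 : b * cross (F (γ 0)) (F (γ 1)) = 0 := by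
      have : cross (F (γ 0)) (F (γ t)) = b * cross (F (γ 0)) (F (γ 1)) := by
        simp only [cross, hre, him]; ring
      rw [← this, k1]
    have hb1 : b = 0 := by
      rcases mul_eq_zero.1 hb0 with h | h
      · exact h
      · exact absurd h hcr.ne'
    have ha1 : a = 1 := by linarith
    subst hb1 ha1
    have := hnp (γ 0) (γ t)
    rw [hre, him] at k2
    nlinarith [mul_self_nonneg (F (γ 0)).re, mul_self_nonneg (F (γ 0)).im]
  · have k1 := key (γ 0) (γ 1)
    rw [k1] at hcr
    exact (mul_pos_iff_of_pos_left (hnp _ _)).1 hcr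

/-- The standard triangle in the plane. -/
def stdTriangle : Set (ℝ × ℝ) := {x | 0 ≤ x.1 ∧ 0 ≤ x.2 ∧ x.1 + x.2 ≤ 1}

/-- A retraction of the plane onto the standard triangle. -/
noncomputable def stdRetract (x : ℝ × ℝ) : ℝ × ℝ :=
  (max x.1 0 / max 1 (max x.1 0 + max x.2 0), max x.2 0 / max 1 (max x.1 0 + max x.2 0))

lemma continuous_stdRetract : Continuous stdRetract := by
  unfold stdRetract
  refine Continuous.prodMk ?_ ?_ <;>
  · refine Continuous.div (by fun_prop) (by fun_prop) fun x => ?_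
    have : (1 : ℝ) ≤ max 1 (max x.1 0 + max x.2 0) := le_max_left _ _
    positivity

lemma stdRetract_mem (x : ℝ × ℝ) : stdRetract x ∈ stdTriangle := by
  have h : (0 : ℝ) < max 1 (max x.1 0 + max x.2 0) := lt_of_lt_of_le one_pos (le_max_left _ _)
  refine ⟨by unfold stdRetract; positivity, by unfold stdRetract; positivity, ?_⟩
  unfold stdRetract
  rw [← add_div, div_le_one h]
  exact le_max_right _ _

lemma stdRetract_eq {x : ℝ × ℝ} (hx : x ∈ stdTriangle) : stdRetract x = x := by
  obtain ⟨h1, h2, h3⟩ := hx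
  unfold stdRetract
  rw [max_eq_left h1, max_eq_left h2, max_eq_left h3]
  simp

/-- If p were missed, f - p would have a continuous angle, yet this angle would increase strictly
along all three sides of a closed circuit. The retraction extends f to the plane so that the lift
exists. -/
lemma exists_mem_stdTriangle_of_cross_pos {f : ℝ × ℝ → ℂ} (hf : ContinuousOn f stdTriangle)
    {A B C p : ℂ} (hA : f (0, 0) = A) (hB : f (1, 0) = B) (hC : f (0, 1) = C)
    (hAB : ∀ t ∈ Set.Icc (0 : ℝ) 1, f (t, 0) ∈ segment ℝ A B)
    (hBC : ∀ t ∈ Set.Icc (0 : ℝ) 1, f (1 - t, t) ∈ segment ℝ B C)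
    (hCA : ∀ t ∈ Set.Icc (0 : ℝ) 1, f (0, 1 - t) ∈ segment ℝ C A)
    (h1 : 0 < cross (A - p) (B - p)) (h2 : 0 < cross (B - p) (C - p))
    (h3 : 0 < cross (C - p) (A - p)) : ∃ x ∈ stdTriangle, f x = p := by
  by_contra hne
  push Not at hne
  set F : ℝ × ℝ → ℂ := fun x => f (stdRetract x) - p with hFdef
  have hF : Continuous F :=
    (hf.comp_continuous continuous_stdRetract stdRetract_mem).sub continuous_const
  have hF0 : ∀ x, F x ≠ 0 := fun x => sub_ne_zero.2 (hne _ (stdRetract_mem x))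
  obtain ⟨g, hg, hFg⟩ := exists_continuous_angle hF hF0
  have hval : ∀ x ∈ stdTriangle, F x = f x - p := fun x hx => by
    simp only [hFdef, stdRetract_eq hx]
  have hseg : ∀ {a b c : ℂ}, c ∈ segment ℝ a b → c - p ∈ segment ℝ (a - p) (b - p) := by
    intro a b c hc
    have := (mem_segment_translate ℝ (-p) (x := c) (b := a) (c := b)).2 hc
    simpa [sub_eq_neg_add] using this
  have vA : F (0, 0) = A - p := by rw [hval _ (by simp [stdTriangle]), hA]
  have vB : F (1, 0) = B - p := by rw [hval _ (by simp [stdTriangle]), hB]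
  have vC : F (0, 1) = C - p := by rw [hval _ (by simp [stdTriangle]), hC]
  have e1 := angle_increases hF0 hg hFg (γ := fun t => (t, 0)) (by fun_prop)
    (by simpa only [vA, vB] using h1) (fun t ht => by
      rw [hval (t, 0) ⟨ht.1, le_rfl, by simpa using ht.2⟩]
      simpa only [vA, vB] using hseg (hAB t ht))
  have e2 := angle_increases hF0 hg hFg (γ := fun t => (1 - t, t)) (by fun_prop)
    (by simpa only [sub_zero, sub_self, vC, vB] using h2) (fun t ht => by
      rw [hval (1 - t, t) ⟨by simpa using ht.2, ht.1, by simp⟩]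
      simpa only [sub_zero, sub_self, vC, vB] using hseg (hBC t ht))
  have e3 := angle_increases hF0 hg hFg (γ := fun t => (0, 1 - t)) (by fun_prop)
    (by simpa only [sub_zero, sub_self, vC, vA] using h3) (fun t ht => by
      rw [hval (0, 1 - t) ⟨le_rfl, by simpa using ht.2, by simpa using ht.1⟩]
      simpa only [sub_zero, sub_self, vC, vA] using hseg (hCA t ht))
  simp only [sub_zero, sub_self] at e1 e2 e3
  linarith

/-- A continuous map of the standard triangle that maps each side into the corresponding side of a
nondegenerate triangle covers the interior of that triangle. -/
lemma exists_mem_stdTriangle {f : ℝ × ℝ → ℂ} (hf : ContinuousOn f stdTriangle)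
    {A B C : ℂ} (hA : f (0, 0) = A) (hB : f (1, 0) = B) (hC : f (0, 1) = C)
    (hAB : ∀ t ∈ Set.Icc (0 : ℝ) 1, f (t, 0) ∈ segment ℝ A B)
    (hBC : ∀ t ∈ Set.Icc (0 : ℝ) 1, f (1 - t, t) ∈ segment ℝ B C)
    (hCA : ∀ t ∈ Set.Icc (0 : ℝ) 1, f (0, 1 - t) ∈ segment ℝ C A)
    (hcr : cross (B - A) (C - A) ≠ 0) {s t : ℝ} (hs : 0 < s) (ht : 0 < t) (hst : s + t < 1) :
    ∃ x ∈ stdTriangle, f x = A + s * (B - A) + t * (C - A) := by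
  have hpos : ∀ a b c : ℂ, 0 < cross (b - a) (c - a) →
      0 < cross (a - (a + s * (b - a) + t * (c - a))) (b - (a + s * (b - a) + t * (c - a))) ∧
      0 < cross (b - (a + s * (b - a) + t * (c - a))) (c - (a + s * (b - a) + t * (c - a))) ∧
      0 < cross (c - (a + s * (b - a) + t * (c - a))) (a - (a + s * (b - a) + t * (c - a))) := by
    intro a b c h
    refine ⟨?_, ?_, ?_⟩
    · refine (mul_pos ht h).trans_eq ?_
      simp [cross]; ring
    · refine (mul_pos (sub_pos.2 hst) h).trans_eq ?_
      simp [cross]; ring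
    · refine (mul_pos hs h).trans_eq ?_
      simp [cross]; ring
  rcases lt_or_gt_of_ne hcr with h | h
  -- A negatively oriented triangle is reduced to a positively oriented one by complex conjugation.
  · have hconj : ∀ {a b c : ℂ}, c ∈ segment ℝ a b →
        (starRingEnd ℂ) c ∈ segment ℝ ((starRingEnd ℂ) a) ((starRingEnd ℂ) b) := by
      rintro a b c ⟨x, y, hx, hy, hxy, rfl⟩
      exact ⟨x, y, hx, hy, hxy, by simp⟩
    obtain ⟨p1, p2, p3⟩ := hpos ((starRingEnd ℂ) A) ((starRingEnd ℂ) B) ((starRingEnd ℂ) C)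
      (by simp only [cross, Complex.sub_re, Complex.sub_im, Complex.conj_re, Complex.conj_im] at h ⊢
          linarith)
    obtain ⟨x, hx, he⟩ := exists_mem_stdTriangle_of_cross_pos
      (f := fun x => (starRingEnd ℂ) (f x)) (Complex.continuous_conj.comp_continuousOn hf)
      (by rw [hA]) (by rw [hB]) (by rw [hC])
      (fun t ht => hconj (hAB t ht)) (fun t ht => hconj (hBC t ht))
      (fun t ht => hconj (hCA t ht)) p1 p2 p3
    refine ⟨x, hx, ?_⟩
    have := congrArg (starRingEnd ℂ) he
    simpa using this
  · obtain ⟨p1, p2, p3⟩ := hpos A B C h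
    exact exists_mem_stdTriangle_of_cross_pos hf hA hB hC hAB hBC hCA p1 p2 p3

/-! ### Barycentric coordinates and the images of triangles -/

section

variable {V : Type*} {T : AbstractSimplicialComplex V}

lemma face_of_subset {K : PreAbstractSimplicialComplex V} {s t : Finset V} (hs : s ∈ K.faces)
    (hts : t ⊆ s) (ht : t.Nonempty) : t ∈ K.faces :=
  (K.isRelLowerSet_faces hs).2 hts ht

lemma nonneg_apply (x : Space T) (v : V) : 0 ≤ (x : V → ℝ) v := by
  obtain ⟨s, -, h, -, -⟩ := x.2
  exact h v

lemma isOpen_pos (v : V) : IsOpen {y : Space T | 0 < (y : V → ℝ) v} :=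
  isOpen_lt continuous_const ((continuous_apply v).comp continuous_subtype_val)

variable [DecidableEq V] {φ : Space T → ℂ} {i j k : V}

lemma IsEdge.symm (h : IsEdge T i j) : IsEdge T j i :=
  ⟨h.1.symm, by rw [Finset.pair_comm]; exact h.2⟩

lemma IsTriangle.swap (h : IsTriangle T i j k) : IsTriangle T i k j :=
  ⟨h.2.2.1, h.2.1.symm, h.1, by rw [Finset.pair_comm k j]; exact h.2.2.2⟩

lemma IsTriangle.rotate (h : IsTriangle T i j k) : IsTriangle T j k i :=
  ⟨h.2.1, h.2.2.1.symm, h.1.symm, by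
    have : ({j, k, i} : Finset V) = {i, j, k} := by ext; simp; tauto
    rw [this]; exact h.2.2.2⟩

lemma IsTriangle.edge (h : IsTriangle T i j k) : IsEdge T i j :=
  ⟨h.1, face_of_subset h.2.2.2 (by intro x; simp; tauto) (by simp)⟩

lemma vertex_apply (i v : V) : (vertex T i : V → ℝ) v = if v = i then 1 else 0 := by
  simp [vertex, Pi.single_apply]

/-- The vertices at which `x` is positive form a face. -/
lemma mem_faces_of_pos {K : PreAbstractSimplicialComplex V} {x : V → ℝ} (hx : x ∈ realization K)
    {s : Finset V} (hs : s.Nonempty) (h : ∀ v ∈ s, 0 < x v) : s ∈ K.faces := by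
  obtain ⟨t, ht, h0, h1, h2⟩ := hx
  refine face_of_subset ht (fun v hv => ?_) hs
  by_contra hvt
  have := h v hv
  rw [h1 v hvt] at this
  exact lt_irrefl _ this

lemma eq_vertex_of_forall_ne (x : Space T) (h : ∀ v, v ≠ i → (x : V → ℝ) v = 0) :
    x = vertex T i := by
  obtain ⟨t, ht, h0, h1, h2⟩ := x.2
  apply Subtype.ext
  funext v
  rw [vertex_apply]
  split_ifs with hv
  · subst hv
    by_cases hvt : v ∈ t
    · rw [← h2, Finset.sum_eq_single_of_mem v hvt fun b _ hb => h b hb]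
    · exfalso
      have : ∑ w ∈ t, (x : V → ℝ) w = 0 :=
        Finset.sum_eq_zero fun w hw => h w fun hwv => hvt (hwv ▸ hw)
      rw [this] at h2
      exact zero_ne_one h2
  · exact h v hv

/-- The total mass of a point supported on a triangle. -/
lemma sum_eq_one_of_triangle (hij : i ≠ j) (hjk : j ≠ k) (hik : i ≠ k) (x : Space T)
    (h : ∀ v, v ≠ i → v ≠ j → v ≠ k → (x : V → ℝ) v = 0) :
    (x : V → ℝ) i + (x : V → ℝ) j + (x : V → ℝ) k = 1 := by
  obtain ⟨t, ht, h0, h1, h2⟩ := x.2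
  have e1 : ∑ v ∈ t, (x : V → ℝ) v = ∑ v ∈ t ∪ {i, j, k}, (x : V → ℝ) v :=
    Finset.sum_subset Finset.subset_union_left fun v _ hv => h1 v hv
  have e2 : ∑ v ∈ ({i, j, k} : Finset V), (x : V → ℝ) v = ∑ v ∈ t ∪ {i, j, k}, (x : V → ℝ) v :=
    Finset.sum_subset Finset.subset_union_right fun v _ hv => by
      simp only [Finset.mem_insert, Finset.mem_singleton, not_or] at hv
      exact h v hv.1 hv.2.1 hv.2.2
  rw [← h2, e1, ← e2, Finset.sum_insert (by simp [hij, hik]), Finset.sum_insert (by simpa using hjk),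
    Finset.sum_singleton, add_assoc]

/-- Barycentric coordinates on the triangle `ijk`. -/
noncomputable def bary (i j k : V) (x : ℝ × ℝ) : V → ℝ :=
  fun v => if v = i then 1 - x.1 - x.2 else if v = j then x.1 else if v = k then x.2 else 0

lemma bary_mem (h : IsTriangle T i j k) {x : ℝ × ℝ} (hx : x ∈ stdTriangle) :
    bary i j k x ∈ realization T.toPreAbstractSimplicialComplex := by
  obtain ⟨h1, h2, h3⟩ := hx
  refine ⟨{i, j, k}, h.2.2.2, fun v => ?_, fun v hv => ?_, ?_⟩
  · unfold bary
    split_ifs <;> linarith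
  · simp only [Finset.mem_insert, Finset.mem_singleton, not_or] at hv
    simp [bary, hv]
  · rw [Finset.sum_insert (by simp [h.1, h.2.2.1]), Finset.sum_insert (by simpa using h.2.1),
      Finset.sum_singleton]
    simp [bary, h.1.symm, h.2.1.symm, h.2.2.1.symm]

/-- Parametrization of the triangle `ijk` of `|T|`, extended to the plane by a retraction. -/
noncomputable def triPoint (h : IsTriangle T i j k) (x : ℝ × ℝ) : Space T :=
  ⟨bary i j k (stdRetract x), bary_mem h (stdRetract_mem x)⟩

lemma triPoint_coe (h : IsTriangle T i j k) {x : ℝ × ℝ} (hx : x ∈ stdTriangle) :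
    (triPoint h x : V → ℝ) = bary i j k x := by
  simp only [triPoint, stdRetract_eq hx]

lemma continuous_triPoint (h : IsTriangle T i j k) : Continuous (triPoint h) := by
  refine Continuous.subtype_mk (continuous_pi fun v => ?_) _
  have h1 := continuous_fst.comp continuous_stdRetract
  have h2 := continuous_snd.comp continuous_stdRetract
  unfold bary
  split_ifs
  exacts [(continuous_const.sub h1).sub h2, h1, h2, continuous_const]

lemma triPoint_apply_of_ne (h : IsTriangle T i j k) (x : ℝ × ℝ) {v : V} (hi : v ≠ i) (hj : v ≠ j)
    (hk : v ≠ k) : (triPoint h x : V → ℝ) v = 0 := by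
  simp [triPoint, bary, hi, hj, hk]

lemma triPoint_surj (h : IsTriangle T i j k) (x : Space T)
    (hx : ∀ v, v ≠ i → v ≠ j → v ≠ k → (x : V → ℝ) v = 0) :
    ((x : V → ℝ) j, (x : V → ℝ) k) ∈ stdTriangle ∧
      triPoint h ((x : V → ℝ) j, (x : V → ℝ) k) = x := by
  have hs := sum_eq_one_of_triangle h.1 h.2.1 h.2.2.1 x hx
  have hm : ((x : V → ℝ) j, (x : V → ℝ) k) ∈ stdTriangle :=
    ⟨nonneg_apply x j, nonneg_apply x k, by have := nonneg_apply x i; simp only; linarith⟩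
  refine ⟨hm, Subtype.ext ?_⟩
  rw [triPoint_coe h hm]
  funext v
  unfold bary
  split_ifs with h1 h2 h3
  · subst h1; simp only; linarith
  · rw [h2]
  · rw [h3]
  · exact (hx v h1 h2 h3).symm

namespace IsGeodesicEmbedding

lemma mem_segment (hφ : IsGeodesicEmbedding T φ) (he : IsEdge T i j) {x : Space T}
    (hx : x ∈ edgeSet T i j) : φ x ∈ segment ℝ (φ (vertex T i)) (φ (vertex T j)) := by
  rw [← hφ.image_edge i j he]
  exact ⟨x, hx, rfl⟩

lemma mem_edgeSet_of_mem_segment (hφ : IsGeodesicEmbedding T φ) (he : IsEdge T i j) {x : Space T}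
    (hx : φ x ∈ segment ℝ (φ (vertex T i)) (φ (vertex T j))) : x ∈ edgeSet T i j := by
  rw [← hφ.image_edge i j he] at hx
  obtain ⟨y, hy, hyx⟩ := hx
  rwa [← hφ.isEmbedding.injective hyx]

/-- The image of a triangle covers the open Euclidean triangle. -/
lemma exists_mem_triangle (hφ : IsGeodesicEmbedding T φ) (h : IsTriangle T i j k)
    (hcr : cross (φ (vertex T j) - φ (vertex T i)) (φ (vertex T k) - φ (vertex T i)) ≠ 0)
    {s t : ℝ} (hs : 0 < s) (ht : 0 < t) (hst : s + t < 1) :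
    ∃ x : Space T, (∀ v, v ≠ i → v ≠ j → v ≠ k → (x : V → ℝ) v = 0) ∧
      φ x = φ (vertex T i) + s * (φ (vertex T j) - φ (vertex T i))
        + t * (φ (vertex T k) - φ (vertex T i)) := by
  have hm : ∀ {a b : ℝ}, 0 ≤ a → 0 ≤ b → a + b ≤ 1 → (a, b) ∈ stdTriangle :=
    fun h1 h2 h3 => ⟨h1, h2, h3⟩
  have hv : ∀ (x : ℝ × ℝ) (w : V), x ∈ stdTriangle → (∀ v, v ≠ w → bary i j k x v = 0) →
      φ (triPoint h x) = φ (vertex T w) := by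
    intro x w hx hw
    rw [eq_vertex_of_forall_ne (triPoint h x) (i := w) fun v hv => by
      rw [triPoint_coe h hx]; exact hw v hv]
  obtain ⟨x, hx, he⟩ := exists_mem_stdTriangle (f := fun x => φ (triPoint h x))
    (hφ.isEmbedding.continuous.comp (continuous_triPoint h)).continuousOn
    (hv (0, 0) i (hm (by simp) (by simp) (by simp)) fun v hvi => by simp [bary, hvi])
    (hv (1, 0) j (hm (by simp) (by simp) (by simp)) fun v hvi => by simp [bary, hvi])
    (hv (0, 1) k (hm (by simp) (by simp) (by simp)) fun v hvi => by simp [bary, hvi])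
    (fun t ht => hφ.mem_segment h.edge fun v h1 h2 => by
      rw [triPoint_coe h (hm ht.1 le_rfl (by simpa using ht.2))]; simp [bary, h1, h2])
    (fun t ht => hφ.mem_segment h.rotate.edge fun v h1 h2 => by
      rw [triPoint_coe h (hm (by simpa using ht.2) ht.1 (by simp))]; simp [bary, h1, h2])
    (fun t ht => hφ.mem_segment h.rotate.rotate.edge fun v h1 h2 => by
      rw [triPoint_coe h (hm le_rfl (by simpa using ht.2) (by simpa using ht.1))]
      simp [bary, h1, h2])
    hcr hs ht hst
  exact ⟨triPoint h x, fun v h1 h2 h3 => triPoint_apply_of_ne h x h1 h2 h3, he⟩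

/-- The interior of a triangle is mapped into the open Euclidean triangle. -/
lemma map_interior (hφ : IsGeodesicEmbedding T φ) (h : IsTriangle T i j k)
    (hcr : cross (φ (vertex T j) - φ (vertex T i)) (φ (vertex T k) - φ (vertex T i)) ≠ 0)
    {x : Space T} (hx : ∀ v, v ≠ i → v ≠ j → v ≠ k → (x : V → ℝ) v = 0)
    (hi : 0 < (x : V → ℝ) i) (hj : 0 < (x : V → ℝ) j) (hk : 0 < (x : V → ℝ) k) :
    ∃ s t : ℝ, 0 < s ∧ 0 < t ∧ s + t < 1 ∧
      φ x = φ (vertex T i) + s * (φ (vertex T j) - φ (vertex T i))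
        + t * (φ (vertex T k) - φ (vertex T i)) := by
  set A := φ (vertex T i) with hA
  set b := φ (vertex T j) - A with hb
  set c := φ (vertex T k) - A with hc
  have hB : φ (vertex T j) = A + b := by rw [hb]; ring
  have hC : φ (vertex T k) = A + c := by rw [hc]; ring
  -- By Cramer's rule `S` and `R` are the affine coordinates with respect to the frame A, b, c.
  let S : ℂ → ℝ := fun p => cross (p - A) c / cross b c
  let R : ℂ → ℝ := fun p => cross b (p - A) / cross b c
  have hS : Continuous S := by unfold S cross; fun_prop
  have hR : Continuous R := by unfold R cross; fun_prop
  have hdec : ∀ p, p = A + S p * b + R p * c := by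
    intro p
    have : (cross b c : ℂ) ≠ 0 := by exact_mod_cast hcr
    have e : (cross b c : ℂ) * (p - A) = cross (p - A) c * b + cross b (p - A) * c := by
      apply Complex.ext <;> simp [cross] <;> ring
    simp only [S, R, Complex.ofReal_div]
    field_simp
    linear_combination e
  have hSv : ∀ s t : ℝ, S (A + s * b + t * c) = s := by
    intro s t
    simp only [S]
    rw [div_eq_iff hcr]
    simp [cross]
    ring
  have hRv : ∀ s t : ℝ, R (A + s * b + t * c) = t := by
    intro s t
    simp only [R]
    rw [div_eq_iff hcr]
    simp [cross]
    ring
  -- on the sides one of the coordinates vanishes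
  have hside : ∀ y : Space T, (∀ v, v ≠ i → v ≠ j → v ≠ k → (y : V → ℝ) v = 0) →
      ((y : V → ℝ) i = 0 ∨ (y : V → ℝ) j = 0 ∨ (y : V → ℝ) k = 0) →
      S (φ y) + R (φ y) = 1 ∨ S (φ y) = 0 ∨ R (φ y) = 0 := by
    intro y hy h0
    rcases h0 with h0 | h0 | h0
    · left
      have := hφ.mem_segment h.rotate.edge (x := y) fun v h1 h2 => by
        by_cases h3 : v = i
        · rw [h3, h0]
        · exact hy v h3 h1 h2
      obtain ⟨m, n, -, -, hmn, he⟩ := this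
      rw [hB, hC] at he
      have : φ y = A + m * b + n * c := by
        rw [← he, Complex.real_smul, Complex.real_smul]
        have : (m : ℂ) + n = 1 := by exact_mod_cast hmn
        linear_combination A * this
      rw [this, hSv, hRv, hmn]
    · right; left
      have := hφ.mem_segment h.swap.edge (x := y) fun v h1 h2 => by
        by_cases h3 : v = j
        · rw [h3, h0]
        · exact hy v h1 h3 h2
      obtain ⟨m, n, -, -, hmn, he⟩ := this
      rw [hC] at he
      have : φ y = A + (0 : ℝ) * b + n * c := by
        rw [← he, Complex.real_smul, Complex.real_smul]
        have : (m : ℂ) + n = 1 := by exact_mod_cast hmn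
        push_cast
        linear_combination A * this
      rw [this, hSv]
    · right; right
      have := hφ.mem_segment h.edge (x := y) fun v h1 h2 => by
        by_cases h3 : v = k
        · rw [h3, h0]
        · exact hy v h1 h2 h3
      obtain ⟨m, n, -, -, hmn, he⟩ := this
      rw [hB] at he
      have : φ y = A + n * b + (0 : ℝ) * c := by
        rw [← he, Complex.real_smul, Complex.real_smul]
        have : (m : ℂ) + n = 1 := by exact_mod_cast hmn
        push_cast
        linear_combination A * this
      rw [this, hRv]
  -- the boundary of the Euclidean triangle is covered by the sides
  have hbd : ∀ y : Space T, 0 ≤ S (φ y) → 0 ≤ R (φ y) → S (φ y) + R (φ y) ≤ 1 →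
      (S (φ y) + R (φ y) = 1 ∨ S (φ y) = 0 ∨ R (φ y) = 0) →
      (y : V → ℝ) i = 0 ∨ (y : V → ℝ) j = 0 ∨ (y : V → ℝ) k = 0 := by
    intro y h1 h2 h3 h0
    have hd := hdec (φ y)
    rcases h0 with h0 | h0 | h0
    · left
      refine hφ.mem_edgeSet_of_mem_segment h.rotate.edge (x := y)
        ⟨S (φ y), R (φ y), h1, h2, h0, ?_⟩ i h.1 h.2.2.1
      rw [Complex.real_smul, Complex.real_smul, hB, hC]
      have : (S (φ y) : ℂ) + R (φ y) = 1 := by exact_mod_cast h0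
      linear_combination A * this - hd
    · right; left
      refine hφ.mem_edgeSet_of_mem_segment h.swap.edge (x := y)
        ⟨1 - R (φ y), R (φ y), by linarith, h2, by ring, ?_⟩ j h.1.symm h.2.1
      rw [Complex.real_smul, Complex.real_smul, hC]
      rw [h0] at hd
      push_cast at hd ⊢
      linear_combination - hd
    · right; right
      refine hφ.mem_edgeSet_of_mem_segment h.edge (x := y)
        ⟨1 - S (φ y), S (φ y), by linarith, h1, by ring, ?_⟩ k h.2.2.1.symm h.2.1.symm
      rw [Complex.real_smul, Complex.real_smul, hB]
      rw [h0] at hd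
      push_cast at hd ⊢
      linear_combination - hd
  let P : Set (ℝ × ℝ) := {y | 0 < y.1 ∧ 0 < y.2 ∧ y.1 + y.2 < 1}
  have hPK : P ⊆ stdTriangle := fun y hy => ⟨hy.1.le, hy.2.1.le, hy.2.2.le⟩
  have hPconv : Convex ℝ P := by
    rintro y ⟨y1, y2, y3⟩ z ⟨z1, z2, z3⟩ m n hm hn hmn
    have : n = 1 - m := by linarith
    subst this
    refine ⟨?_, ?_, ?_⟩ <;> simp only [Prod.fst_add, Prod.snd_add, Prod.smul_fst, Prod.smul_snd,
      smul_eq_mul] <;> rcases hm.eq_or_lt with rfl | hm' <;> nlinarith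
  let G : ℝ × ℝ → ℂ := fun y => φ (triPoint h y)
  have hG : Continuous G := hφ.isEmbedding.continuous.comp (continuous_triPoint h)
  -- `U` is the open Euclidean triangle and `W` the complement of the closed one. The image of the
  -- open standard triangle is connected and, by injectivity, misses the Euclidean boundary, which
  -- the edges already cover. It contains the centroid by the winding argument, hence it stays in
  -- `U`.
  let U : Set ℂ := {p | 0 < S p ∧ 0 < R p ∧ S p + R p < 1}
  let W : Set ℂ := {p | S p < 0} ∪ {p | R p < 0} ∪ {p | 1 < S p + R p}
  have hU : IsOpen U := (isOpen_lt continuous_const hS).inter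
    ((isOpen_lt continuous_const hR).inter (isOpen_lt (hS.add hR) continuous_const))
  have hW : IsOpen W := ((isOpen_lt hS continuous_const).union
    (isOpen_lt hR continuous_const)).union (isOpen_lt continuous_const (hS.add hR))
  have hUW : Disjoint U W := by
    rw [Set.disjoint_left]
    rintro p ⟨h1, h2, h3⟩ ((h4 | h4) | h4) <;> simp only [Set.mem_ofPred_eq] at h4 <;> linarith
  have hpos : ∀ y ∈ P, 0 < (triPoint h y : V → ℝ) i ∧ 0 < (triPoint h y : V → ℝ) j ∧
      0 < (triPoint h y : V → ℝ) k := by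
    intro y hy
    rw [triPoint_coe h (hPK hy)]
    simp only [bary, h.1.symm, h.2.2.1.symm, h.2.1.symm, if_true, if_false]
    exact ⟨by linarith [hy.2.2], hy.1, hy.2.1⟩
  have hcov : G '' P ⊆ U ∪ W := by
    rintro _ ⟨y, hy, rfl⟩
    by_contra hn
    simp only [U, W, Set.mem_union, Set.mem_ofPred_eq, not_or, not_lt, not_and] at hn
    obtain ⟨hn1, ⟨hn2, hn3⟩, hn4⟩ := hn
    have := hbd (triPoint h y) hn2 hn3 hn4 (by
      by_contra hc
      push Not at hc
      exact absurd (hn1 (lt_of_le_of_ne hn2 hc.2.1.symm) (lt_of_le_of_ne hn3 hc.2.2.symm))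
        (not_le.2 (lt_of_le_of_ne hn4 hc.1)))
    obtain ⟨p1, p2, p3⟩ := hpos y hy
    rcases this with h | h | h <;> linarith
  have hne : (G '' P ∩ U).Nonempty := by
    obtain ⟨y, hy, hye⟩ := hφ.exists_mem_triangle h hcr (s := 1 / 3) (t := 1 / 3) (by norm_num)
      (by norm_num) (by norm_num)
    have s1 : S (φ y) = 1 / 3 := by rw [hye, hSv]
    have s2 : R (φ y) = 1 / 3 := by rw [hye, hRv]
    have h0 : ¬ ((y : V → ℝ) i = 0 ∨ (y : V → ℝ) j = 0 ∨ (y : V → ℝ) k = 0) := by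
      intro h0
      have := hside y hy h0
      rw [s1, s2] at this
      norm_num at this
    push Not at h0
    obtain ⟨hm, htp⟩ := triPoint_surj h y hy
    have hsum := sum_eq_one_of_triangle h.1 h.2.1 h.2.2.1 y hy
    have q1 := lt_of_le_of_ne (nonneg_apply y i) h0.1.symm
    refine ⟨φ y, ⟨((y : V → ℝ) j, (y : V → ℝ) k), ⟨?_, ?_, ?_⟩, by simp only [G, htp]⟩, ?_⟩
    · exact lt_of_le_of_ne (nonneg_apply y j) h0.2.1.symm
    · exact lt_of_le_of_ne (nonneg_apply y k) h0.2.2.symm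
    · simp only; linarith
    · simp only [U, Set.mem_ofPred_eq, s1, s2]; norm_num
  have hsub : G '' P ⊆ U :=
    (hPconv.isPreconnected.image G hG.continuousOn).subset_left_of_subset_union hU hW hUW hcov hne
  obtain ⟨hm, htp⟩ := triPoint_surj h x hx
  have hsum := sum_eq_one_of_triangle h.1 h.2.1 h.2.2.1 x hx
  obtain ⟨u1, u2, u3⟩ := hsub ⟨((x : V → ℝ) j, (x : V → ℝ) k),
    ⟨hj, hk, by simp only; linarith⟩, by simp only [G, htp]; rfl⟩
  exact ⟨S (φ x), R (φ x), u1, u2, u3, hdec (φ x)⟩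

end IsGeodesicEmbedding

end

/-! ### Monotonicity of the total angle for convex polygons with fixed sides -/

/-- Sixteen times the squared area of the triangle with squared side lengths `c ^ 2`, `x`, `y`. -/
def heron (c x y : ℝ) : ℝ := 4 * x * y - (x + y - c ^ 2) ^ 2

/-- The angle opposite to the side `c` of the triangle with squared side lengths `c ^ 2`, `x`, `y`. -/
noncomputable def apexAngle (c x y : ℝ) : ℝ :=
  Real.pi / 2 - Real.arctan ((x + y - c ^ 2) / √(heron c x y))

lemma heron_eq (c x y : ℝ) : heron c x y = c ^ 2 * (4 * x - ((x + c ^ 2 - y) / c) ^ 2) ∨ c = 0 := by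
  by_cases hc : c = 0
  · exact Or.inr hc
  · left
    rw [heron]
    field_simp
    ring

lemma heron_comm (c x y : ℝ) : heron c x y = heron c y x := by
  rw [heron, heron]; ring

lemma pos_of_heron_pos {c x y : ℝ} (h : 0 < heron c x y) : 0 < x * y := by
  rw [heron] at h
  nlinarith [sq_nonneg (x + y - c ^ 2)]

/-- In the squared side x the apex angle has derivative -cot β / (2x), where β is the angle between
this side and c, and cot β = (x + c² - y) / √heron. -/
lemma hasDerivAt_apexAngle {c x y p q t : ℝ}
    (h : 0 < heron c (x + t * p) (y + t * q)) :
    HasDerivAt (fun t => apexAngle c (x + t * p) (y + t * q))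
      (-(p / (2 * (x + t * p)) * ((x + t * p + c ^ 2 - (y + t * q)) / √(heron c (x + t * p) (y + t * q)))
        + q / (2 * (y + t * q)) * ((y + t * q + c ^ 2 - (x + t * p)) / √(heron c (x + t * p) (y + t * q)))))
      t := by
  have hx : HasDerivAt (fun t => x + t * p) p t := by
    simpa using ((hasDerivAt_id t).mul_const p).const_add x
  have hy : HasDerivAt (fun t => y + t * q) q t := by
    simpa using ((hasDerivAt_id t).mul_const q).const_add y
  have hN := (hx.add hy).sub_const (c ^ 2)
  have hH := ((hx.const_mul 4).mul hy).sub (hN.pow 2)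
  have hD := ((hN.div (hH.sqrt h.ne') (Real.sqrt_pos.2 h).ne').arctan).const_sub (Real.pi / 2)
  refine hD.congr_deriv ?_
  have hxy := pos_of_heron_pos h
  have hx0 : x + t * p ≠ 0 := fun h0 => by rw [h0] at hxy; simp at hxy
  have hy0 : y + t * q ≠ 0 := fun h0 => by rw [h0] at hxy; simp at hxy
  simp only [Pi.add_apply, Pi.sub_apply, Pi.mul_apply, Pi.pow_apply, Pi.div_apply]
  have hh : 4 * (x + t * p) * (y + t * q) - (x + t * p + (y + t * q) - c ^ 2) ^ 2
    = heron c (x + t * p) (y + t * q) := rfl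
  rw [hh]
  set X := x + t * p
  set Y := y + t * q
  set r := √(heron c X Y) with hr
  have hr0 : r ≠ 0 := (Real.sqrt_pos.2 h).ne'
  have hr2 : r ^ 2 = 4 * X * Y - (X + Y - c ^ 2) ^ 2 := Real.sq_sqrt h.le
  have h1 : 1 + ((X + Y - c ^ 2) / r) ^ 2 = 4 * X * Y / r ^ 2 := by
    field_simp
    linear_combination hr2
  rw [h1]
  field_simp
  rw [hr2]
  push_cast
  ring

lemma div_sqrt_lt_div_sqrt {K x y : ℝ} (hx : x ^ 2 < K) (hy : y ^ 2 < K) (hxy : x < y) :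
    x / √(K - x ^ 2) < y / √(K - y ^ 2) := by
  have key : ∀ {x y : ℝ}, x ^ 2 < K → y ^ 2 < K → 0 ≤ x → x < y →
      x / √(K - x ^ 2) < y / √(K - y ^ 2) := by
    intro x y hx hy h0 hxy
    have h1 : 0 < √(K - y ^ 2) := Real.sqrt_pos.2 (by linarith)
    have h2 : √(K - y ^ 2) ≤ √(K - x ^ 2) := Real.sqrt_le_sqrt (by nlinarith)
    exact (div_le_div_of_nonneg_left h0 h1 h2).trans_lt (div_lt_div_of_pos_right hxy h1)
  have sx : 0 < √(K - x ^ 2) := Real.sqrt_pos.2 (by linarith)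
  have sy : 0 < √(K - y ^ 2) := Real.sqrt_pos.2 (by linarith)
  rcases le_or_gt 0 x with h | h
  · exact key hx hy h hxy
  · rcases le_or_gt 0 y with h' | h'
    · exact (div_neg_of_neg_of_pos h sx).trans_le (div_nonneg h' sy.le)
    · have := key (x := -y) (y := -x) (by simpa using hy) (by simpa using hx) (by linarith)
        (by linarith)
      rw [neg_sq, neg_sq, neg_div, neg_div] at this
      linarith

/-- X/c and Y/d are 2√z times the cosines of two angles at a common vertex, and the summands in the
conclusion are their cotangents. Since x ↦ x / √(4z - x²) is odd and strictly increasing, the sign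
of the sum passes from cosines to cotangents. -/
lemma cot_add_cot {c d X Y z : ℝ} (hc : 0 < c) (hd : 0 < d)
    (h1 : 0 < c ^ 2 * (4 * z - (X / c) ^ 2)) (h2 : 0 < d ^ 2 * (4 * z - (Y / d) ^ 2)) :
    (0 ≤ X / c + Y / d → 0 ≤ X / √(c ^ 2 * (4 * z - (X / c) ^ 2)) + Y / √(d ^ 2 * (4 * z - (Y / d) ^ 2))) ∧
    (0 < X / c + Y / d → 0 < X / √(c ^ 2 * (4 * z - (X / c) ^ 2)) + Y / √(d ^ 2 * (4 * z - (Y / d) ^ 2)))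
      := by
  have e1 : X / √(c ^ 2 * (4 * z - (X / c) ^ 2)) = (X / c) / √(4 * z - (X / c) ^ 2) := by
    rw [Real.sqrt_mul (sq_nonneg c), Real.sqrt_sq hc.le, div_div]
  have e2 : Y / √(d ^ 2 * (4 * z - (Y / d) ^ 2)) = (Y / d) / √(4 * z - (Y / d) ^ 2) := by
    rw [Real.sqrt_mul (sq_nonneg d), Real.sqrt_sq hd.le, div_div]
  rw [e1, e2]
  have k1 : (X / c) ^ 2 < 4 * z := by
    have := (mul_pos_iff_of_pos_left (by positivity)).1 h1; linarith
  have k2 : (-(Y / d)) ^ 2 < 4 * z := by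
    have := (mul_pos_iff_of_pos_left (by positivity)).1 h2; rw [neg_sq]; linarith
  have main : -(Y / d) < X / c → 0 < X / c / √(4 * z - (X / c) ^ 2) + Y / d / √(4 * z - (Y / d) ^ 2) := by
    intro h
    have := div_sqrt_lt_div_sqrt k2 k1 h
    rw [neg_sq, neg_div] at this
    linarith
  refine ⟨fun h => ?_, fun h => main (by linarith)⟩
  rcases h.eq_or_lt with h | h
  · have : X / c = -(Y / d) := by linarith
    rw [this, neg_sq, neg_div]
    simp
  · exact (main (by linarith)).le

/-- Two convex polygons with the same side lengths: if the distances from a base point to the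
vertices increase, the total angle at the base point decreases. -/
lemma sum_apexAngle_lt {ι : Type*} [Fintype ι] [Nonempty ι] (σ : Equiv.Perm ι) {c ρ ρ' : ι → ℝ}
    (hc : ∀ j, 0 < c j)
    (hH : ∀ j, 0 < heron (c j) (ρ j) (ρ (σ j)))
    (hH' : ∀ j, 0 < heron (c j) (ρ' j) (ρ' (σ j)))
    (hconv : ∀ j, 0 ≤ (ρ (σ j) + c j ^ 2 - ρ j) / c j
      + (ρ (σ j) + c (σ j) ^ 2 - ρ (σ (σ j))) / c (σ j))
    (hconv' : ∀ j, 0 ≤ (ρ' (σ j) + c j ^ 2 - ρ' j) / c j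
      + (ρ' (σ j) + c (σ j) ^ 2 - ρ' (σ (σ j))) / c (σ j))
    (hpos : ∀ j, 0 < ρ' j) (hlt : ∀ j, ρ' j < ρ j) :
    ∑ j, apexAngle (c j) (ρ j) (ρ (σ j)) < ∑ j, apexAngle (c j) (ρ' j) (ρ' (σ j)) := by
  -- The squared distances are interpolated linearly. The intermediate families of triangles need
  -- not close up to a polygon; only nondegeneracy and convexity at each vertex are needed.
  let p : ι → ℝ := fun j => ρ j - ρ' j
  have hp : ∀ j, 0 < p j := fun j => sub_pos.2 (hlt j)
  let z : ℝ → ι → ℝ := fun t j => ρ' j + t * p j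
  have hz1 : ∀ j, z 1 j = ρ j := fun j => by simp [z, p]
  have hz0 : ∀ j, z 0 j = ρ' j := fun j => by simp [z]
  have hzp : ∀ t ∈ Set.Icc (0 : ℝ) 1, ∀ j, 0 < z t j := fun t ht j =>
    add_pos_of_pos_of_nonneg (hpos j) (mul_nonneg ht.1 (hp j).le)
  have hzH : ∀ t ∈ Set.Icc (0 : ℝ) 1, ∀ j, 0 < heron (c j) (z t j) (z t (σ j)) := by
    intro t ht j
    -- The Heron expression is concave along the interpolation, hence positive between its positive
    -- end values.
    have e : heron (c j) (z t j) (z t (σ j)) = (1 - t) * heron (c j) (ρ' j) (ρ' (σ j))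
        + t * heron (c j) (ρ j) (ρ (σ j)) + t * (1 - t) * (p j - p (σ j)) ^ 2 := by
      simp only [heron, z, p]; ring
    rw [e]
    have h1 := hH j
    have h2 := hH' j
    have h3 : 0 ≤ t * (1 - t) * (p j - p (σ j)) ^ 2 :=
      mul_nonneg (mul_nonneg ht.1 (by linarith [ht.2])) (sq_nonneg _)
    rcases ht.1.eq_or_lt with h | h
    · subst h; linarith
    · have := mul_nonneg (sub_nonneg.2 ht.2) h2.le
      have := mul_pos h h1
      linarith
  -- By the law of cosines this is twice the distance to vertex `σ j` times the sum of the cosines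
  -- of the two angles there, so nonnegativity means that these angles add up to at most π. It is
  -- affine in t because the sides are fixed.
  let w : ℝ → ι → ℝ := fun t j => (z t (σ j) + c j ^ 2 - z t j) / c j
      + (z t (σ j) + c (σ j) ^ 2 - z t (σ (σ j))) / c (σ j)
  have hzc : ∀ t ∈ Set.Icc (0 : ℝ) 1, ∀ j, 0 ≤ w t j := by
    intro t ht j
    have e : w t j = (1 - t) * ((ρ' (σ j) + c j ^ 2 - ρ' j) / c j
      + (ρ' (σ j) + c (σ j) ^ 2 - ρ' (σ (σ j))) / c (σ j))
        + t * ((ρ (σ j) + c j ^ 2 - ρ j) / c j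
      + (ρ (σ j) + c (σ j) ^ 2 - ρ (σ (σ j))) / c (σ j)) := by
      simp only [w, z, p]; ring
    rw [e]
    exact add_nonneg (mul_nonneg (by linarith [ht.2]) (hconv' j)) (mul_nonneg ht.1 (hconv j))
  have hzs : ∀ t, 0 < ∑ j, w t j := by
    intro t
    -- The differences of squared distances cancel along `σ` and leave twice the perimeter, so
    -- convexity is strict at some vertex.
    have e : ∑ j, w t j = ∑ j, 2 * c j := by
      have e1 : ∑ j, (z t (σ j) + c (σ j) ^ 2 - z t (σ (σ j))) / c (σ j)
          = ∑ j, (z t j + c j ^ 2 - z t (σ j)) / c j :=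
        Equiv.sum_comp σ fun j => (z t j + c j ^ 2 - z t (σ j)) / c j
      simp only [w]
      rw [Finset.sum_add_distrib, e1, ← Finset.sum_add_distrib]
      refine Finset.sum_congr rfl fun j _ => ?_
      have := (hc j).ne'
      field_simp
      ring
    rw [e]
    exact Finset.sum_pos (fun j _ => by have := hc j; positivity) Finset.univ_nonempty
  let C : ℝ → ι → ℝ := fun t j =>
    (z t (σ j) + c j ^ 2 - z t j) / √(heron (c j) (z t j) (z t (σ j)))
      + (z t (σ j) + c (σ j) ^ 2 - z t (σ (σ j))) / √(heron (c (σ j)) (z t (σ j)) (z t (σ (σ j))))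
  have hC : ∀ t ∈ Set.Icc (0 : ℝ) 1, ∀ j, (0 ≤ w t j → 0 ≤ C t j) ∧ (0 < w t j → 0 < C t j) := by
    intro t ht j
    have h1 := hzH t ht j
    have h2 := hzH t ht (σ j)
    have e1 := (heron_eq (c j) (z t (σ j)) (z t j)).resolve_right (hc j).ne'
    have e2 := (heron_eq (c (σ j)) (z t (σ j)) (z t (σ (σ j)))).resolve_right (hc (σ j)).ne'
    rw [heron_comm] at e1
    simp only [C]
    rw [e1] at h1 ⊢
    rw [e2] at h2 ⊢
    exact cot_add_cot (hc j) (hc (σ j)) h1 h2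
  let Θ : ℝ → ℝ := fun t => ∑ j, apexAngle (c j) (z t j) (z t (σ j))
  have hderiv : ∀ t ∈ Set.Icc (0 : ℝ) 1,
      HasDerivAt Θ (-∑ j, p (σ j) / (2 * z t (σ j)) * C t j) t := by
    intro t ht
    have h1 := HasDerivAt.fun_sum (u := Finset.univ)
      fun j (_ : j ∈ Finset.univ) => hasDerivAt_apexAngle (hzH t ht j)
    refine h1.congr_deriv ?_
    rw [Finset.sum_neg_distrib, neg_inj, Finset.sum_add_distrib]
    -- Reindexing collects the two cotangents at the vertex `σ j`, which come from the triangles on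
    -- either side of it.
    have e1 := Equiv.sum_comp σ fun j => p j / (2 * (ρ' j + t * p j)) *
      ((ρ' j + t * p j + c j ^ 2 - (ρ' (σ j) + t * p (σ j)))
        / √(heron (c j) (ρ' j + t * p j) (ρ' (σ j) + t * p (σ j))))
    rw [← e1, ← Finset.sum_add_distrib]
    refine Finset.sum_congr rfl fun j _ => ?_
    simp only [C, z]
    ring
  have hanti : StrictAntiOn Θ (Set.Icc 0 1) := by
    refine strictAntiOn_of_deriv_neg (convex_Icc 0 1)
      (fun t ht => (hderiv t ht).continuousAt.continuousWithinAt) fun t ht => ?_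
    rw [interior_Icc] at ht
    have ht' := Set.Ioo_subset_Icc_self ht
    rw [(hderiv t ht').deriv, neg_lt_zero]
    have hcoef : ∀ j, 0 < p (σ j) / (2 * z t (σ j)) := fun j =>
      div_pos (hp _) (by have := hzp t ht' (σ j); positivity)
    obtain ⟨j, -, hj⟩ : ∃ j ∈ Finset.univ, 0 < w t j := by
      by_contra hn
      push Not at hn
      exact absurd (hzs t) (not_lt.2 (Finset.sum_nonpos hn))
    exact Finset.sum_pos' (fun k _ => mul_nonneg (hcoef k).le ((hC t ht' k).1 (hzc t ht' k)))
      ⟨j, Finset.mem_univ j, mul_pos (hcoef j) ((hC t ht' j).2 hj)⟩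
  have := hanti (Set.left_mem_Icc.2 zero_le_one) (Set.right_mem_Icc.2 zero_le_one) zero_lt_one
  simpa only [Θ, hz0, hz1] using this

/-! ### Planar vectors, arguments and inversion -/

/-- The real scalar product of two complex numbers. -/
def dot (a b : ℂ) : ℝ := a.re * b.re + a.im * b.im

lemma dot_self (a : ℂ) : dot a a = ‖a‖ ^ 2 := by
  rw [← Complex.normSq_eq_norm_sq, Complex.normSq_apply, dot]

lemma dot_sq_add_cross_sq (a b : ℂ) : dot a b ^ 2 + cross a b ^ 2 = ‖a‖ ^ 2 * ‖b‖ ^ 2 := by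
  rw [← dot_self, ← dot_self]; simp only [dot, cross]; ring

lemma norm_sub_sq (a b : ℂ) : ‖a - b‖ ^ 2 = ‖a‖ ^ 2 + ‖b‖ ^ 2 - 2 * dot a b := by
  rw [← dot_self, ← dot_self, ← dot_self]; simp only [dot, Complex.sub_re, Complex.sub_im]; ring

lemma div_im_eq (a b : ℂ) : (b / a).im = cross a b / ‖a‖ ^ 2 := by
  rw [Complex.div_im, Complex.normSq_eq_norm_sq, cross]; ring

lemma div_re_eq (a b : ℂ) : (b / a).re = dot a b / ‖a‖ ^ 2 := by
  rw [Complex.div_re, Complex.normSq_eq_norm_sq, dot]; ring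

lemma cross_pos_iff {a b : ℂ} (ha : a ≠ 0) : 0 < cross a b ↔ 0 < (b / a).im := by
  rw [div_im_eq, div_pos_iff_of_pos_right (by positivity)]

lemma arg_pos_iff_im {z : ℂ} (hz : z.im ≠ 0) : 0 < z.arg ↔ 0 < z.im := by
  constructor
  · intro h
    exact lt_of_le_of_ne (Complex.arg_nonneg_iff.1 h.le) hz.symm
  · intro h
    refine lt_of_le_of_ne (Complex.arg_nonneg_iff.2 h.le) fun h0 => hz ?_
    rw [eq_comm, Complex.arg_eq_zero_iff] at h0
    exact h0.2

lemma heron_norm (x y : ℂ) : heron ‖y - x‖ (‖x‖ ^ 2) (‖y‖ ^ 2) = 4 * cross x y ^ 2 := by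
  rw [heron, norm_sub_sq]
  have h1 := dot_sq_add_cross_sq x y
  have h2 : dot y x = dot x y := by simp only [dot]; ring
  rw [h2]
  linear_combination -4 * h1

/-- With θ = |arg(y/x)|, the quotient under the arctangent is dot/|cross| = cot θ = tan(π/2 - θ). -/
lemma apexAngle_norm {x y : ℂ} (h : cross x y ≠ 0) :
    apexAngle ‖y - x‖ (‖x‖ ^ 2) (‖y‖ ^ 2) = |(y / x).arg| := by
  have hx : x ≠ 0 := fun h0 => h (by simp [h0, cross])
  have hy : y ≠ 0 := fun h0 => h (by simp [h0, cross])
  have hnx := norm_pos_iff.2 hx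
  have hny := norm_pos_iff.2 hy
  set θ := |(y / x).arg| with hθ
  have hq : y / x ≠ 0 := div_ne_zero hy hx
  have hcos : Real.cos θ = dot x y / (‖x‖ * ‖y‖) := by
    rw [hθ, Real.cos_abs, Complex.cos_arg hq, div_re_eq, norm_div]
    field_simp
  have hsin : Real.sin θ = |cross x y| / (‖x‖ * ‖y‖) := by
    rw [hθ, ← Real.abs_sin_eq_sin_abs_of_abs_le_pi (Complex.abs_arg_le_pi _), Complex.sin_arg,
      div_im_eq, norm_div, abs_div, abs_div, abs_of_pos (div_pos hny hnx),
      abs_of_pos (pow_pos hnx 2)]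
    field_simp
  have hθ0 : 0 < θ := by
    refine abs_pos.2 fun h0 => h ?_
    have := Complex.sin_arg (y / x)
    rw [h0, Real.sin_zero, div_im_eq, norm_div] at this
    have h3 : cross x y / ‖x‖ ^ 2 / (‖y‖ / ‖x‖) = cross x y / (‖x‖ * ‖y‖) := by field_simp
    rw [h3, eq_comm, div_eq_zero_iff] at this
    exact this.resolve_right (by positivity)
  have hθπ : θ < Real.pi := by
    refine lt_of_le_of_ne (Complex.abs_arg_le_pi _) fun h0 => h ?_
    have h0' : θ = Real.pi := h0
    rw [h0', Real.sin_pi, eq_comm, div_eq_zero_iff] at hsin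
    exact abs_eq_zero.1 (hsin.resolve_right (by positivity))
  rw [apexAngle, heron_norm, norm_sub_sq]
  have h2 : dot y x = dot x y := by simp only [dot]; ring
  have e : (‖x‖ ^ 2 + ‖y‖ ^ 2 - (‖y‖ ^ 2 + ‖x‖ ^ 2 - 2 * dot y x)) / √(4 * cross x y ^ 2)
      = Real.tan (Real.pi / 2 - θ) := by
    rw [Real.tan_eq_sin_div_cos, Real.sin_pi_div_two_sub, Real.cos_pi_div_two_sub, hcos, hsin, h2,
      show 4 * cross x y ^ 2 = (2 * |cross x y|) ^ 2 by rw [mul_pow, sq_abs]; norm_num,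
      Real.sqrt_sq (by positivity)]
    have := abs_ne_zero.2 h
    field_simp
    ring
  rw [e, Real.arctan_tan (by linarith) (by linarith)]
  ring

/-- The argument is the imaginary part of log(1 - w), and |log(1 - w)| ≤ 3|w|/2 ≤ 3ε/8. -/
lemma abs_arg_one_sub_lt {ε : ℝ} (hε : 0 < ε) (hε1 : ε ≤ 1) {w : ℂ} (hw : ‖w‖ ≤ ε / 4) :
    |(1 - w).arg| < ε / 2 := by
  have h1 := Complex.norm_log_one_add_half_le_self (z := -w) (by rw [norm_neg]; linarith)
  rw [norm_neg, ← sub_eq_add_neg] at h1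
  have h2 := Complex.abs_im_le_norm (Complex.log (1 - w))
  rw [Complex.log_im] at h2
  linarith

lemma one_sub_ne_zero {ε : ℝ} (hε1 : ε ≤ 1) {w : ℂ} (hw : ‖w‖ ≤ ε / 4) : 1 - w ≠ 0 := by
  intro h
  have : w = 1 := (sub_eq_zero.1 h).symm
  rw [this, norm_one] at hw
  linarith

/-- The quotient equals (b/a)⁻¹ (1 - db)/(1 - da). The argument of b/a keeps distance ε from ±π and
the two corrections are each below ε/2, so arguments add without a jump of 2π. -/
lemma arg_inv_sub_div {ε : ℝ} (hε : 0 < ε) (hε1 : ε ≤ 1) {a b d : ℂ} (ha : a ≠ 0) (hb : b ≠ 0)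
    (h2 : |(b / a).arg| ≤ Real.pi - ε)
    (hda : ‖d * a‖ ≤ ε / 4) (hdb : ‖d * b‖ ≤ ε / 4) :
    ((b⁻¹ - d) / (a⁻¹ - d)).arg = -(b / a).arg + (1 - d * b).arg - (1 - d * a).arg := by
  have na := one_sub_ne_zero hε1 hda
  have nb := one_sub_ne_zero hε1 hdb
  have e : (b⁻¹ - d) / (a⁻¹ - d) = (b / a)⁻¹ * (1 - d * b) / (1 - d * a) := by
    have : a⁻¹ - d ≠ 0 := by
      intro h0
      apply na
      have : (a⁻¹ - d) * a = 0 := by rw [h0, zero_mul]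
      rw [sub_mul, inv_mul_cancel₀ ha] at this
      exact this
    field_simp
  have hq : (b / a)⁻¹ ≠ 0 := inv_ne_zero (div_ne_zero hb ha)
  have hA : (((b⁻¹ - d) / (a⁻¹ - d)).arg : Real.Angle)
      = ((-(b / a).arg + (1 - d * b).arg - (1 - d * a).arg : ℝ) : Real.Angle) := by
    rw [e, Complex.arg_div_coe_angle (mul_ne_zero hq nb) na, Complex.arg_mul_coe_angle hq nb,
      Complex.arg_inv_coe_angle]
    simp
  have g1 := abs_lt.1 (abs_arg_one_sub_lt hε hε1 hda)
  have g2 := abs_lt.1 (abs_arg_one_sub_lt hε hε1 hdb)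
  have g3 := abs_le.1 h2
  rw [Complex.arg_coe_angle_eq_iff_eq_toReal, Real.Angle.toReal_coe_eq_self_iff.2] at hA
  · exact hA
  · constructor <;> linarith [g1.1, g1.2, g2.1, g2.2, g3.1, g3.2]

/-! ### Stars and their inversions -/

/-- The star of an interior vertex of a triangulated plane in the complex plane, as a cyclic family
of vectors: the neighbours of `j` are `σ j` and `σ⁻¹ j`. -/
structure IsStar {ι : Type*} (σ : Equiv.Perm ι) (ε : ℝ) (h : ι → ℂ) : Prop where
  ne_zero : ∀ j, h j ≠ 0
  le_arg : ∀ j, ε ≤ |(h (σ j) / h j).arg|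
  arg_le : ∀ j, |(h (σ j) / h j).arg| ≤ Real.pi - ε
  cross_pos_iff : ∀ j, 0 < cross (h j) (h (σ j)) ↔ 0 < cross (h (σ j)) (h (σ (σ j)))
  -- The Delaunay condition in cosine form: the two angles are those opposite to the spoke `h (σ
  -- j)`.
  delaunay : ∀ j, 0 ≤ dot (h j) (h j - h (σ j)) / (‖h j‖ * ‖h j - h (σ j)‖)
    + dot (h (σ (σ j))) (h (σ (σ j)) - h (σ j)) / (‖h (σ (σ j))‖ * ‖h (σ (σ j)) - h (σ j)‖)

/-- For a = R cos α, s = R sin α, b = R cos β, t = R sin β with α, β in (0, π), positivity of cos α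
+ cos β forces sin(α + β) > 0. -/
lemma convex_aux_pos {a b s t : ℝ} (hs : 0 < s) (ht : 0 < t) (h : a ^ 2 + s ^ 2 = b ^ 2 + t ^ 2)
    (hab : 0 < a + b) : 0 < a * t + b * s := by
  rcases le_or_gt 0 a with ha | ha
  · rcases le_or_gt 0 b with hb | hb
    · rcases ha.eq_or_lt with ha' | ha'
      · have : 0 < b := by linarith
        have := mul_pos this hs
        nlinarith
      · have := mul_pos ha' ht
        have := mul_nonneg hb hs.le
        linarith
    · have h1 : b ^ 2 < a ^ 2 := by nlinarith
      have h2 : s < t := by nlinarith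
      nlinarith
  · have hb : 0 < b := by linarith
    have h1 : a ^ 2 < b ^ 2 := by nlinarith
    have h2 : t < s := by nlinarith
    nlinarith

lemma convex_aux {a b s t : ℝ} (hs : 0 < s) (ht : 0 < t) (h : a ^ 2 + s ^ 2 = b ^ 2 + t ^ 2) :
    0 ≤ a + b ↔ 0 ≤ a * t + b * s := by
  constructor
  · intro hab
    rcases hab.eq_or_lt with hab | hab
    · have h1 : b = -a := by linarith
      subst h1
      have : s = t := by
        have : s ^ 2 = t ^ 2 := by linarith
        exact (pow_left_inj₀ hs.le ht.le two_ne_zero).1 this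
      subst this
      linarith
    · exact (convex_aux_pos hs ht h hab).le
  · intro hab
    by_contra hn
    have := convex_aux_pos (a := -a) (b := -b) hs ht (by rw [neg_sq, neg_sq]; exact h) (by linarith)
    linarith

/-- Whether an angle of a polygon is at most `π` does not depend on the base point in it. -/
lemma convex_iff {x e f : ℂ} (he : e ≠ 0) (hf : f ≠ 0) (h1 : 0 < cross x e) (h2 : cross x f < 0) :
    0 ≤ dot x e / ‖e‖ + dot x f / ‖f‖ ↔ cross e f ≤ 0 := by
  have hne := norm_pos_iff.2 he
  have hnf := norm_pos_iff.2 hf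
  have hx : x ≠ 0 := fun h0 => by simp [h0, cross] at h1
  have hnx := norm_pos_iff.2 hx
  have d1 := dot_sq_add_cross_sq x e
  have d2 := dot_sq_add_cross_sq x f
  rw [convex_aux (s := cross x e / ‖e‖) (t := -cross x f / ‖f‖) (div_pos h1 hne)
    (div_pos (by linarith) hnf)]
  · have : dot x e / ‖e‖ * (-cross x f / ‖f‖) + dot x f / ‖f‖ * (cross x e / ‖e‖)
        = -cross e f * (‖x‖ ^ 2 / (‖e‖ * ‖f‖)) := by
      rw [← dot_self]
      field_simp
      simp only [dot, cross]
      ring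
    rw [this, mul_nonneg_iff_of_pos_right (by positivity), neg_nonneg]
  · have q1 : (dot x e / ‖e‖) ^ 2 + (cross x e / ‖e‖) ^ 2 = ‖x‖ ^ 2 := by
      field_simp; linarith
    have q2 : (dot x f / ‖f‖) ^ 2 + (-cross x f / ‖f‖) ^ 2 = ‖x‖ ^ 2 := by
      field_simp; linarith
    rw [q1, q2]

/-- Both inequalities are equivalent to the same sign condition on `cross e f`, in which the base
point does not occur. -/
lemma convex_transfer {x y e f : ℂ} (h1 : (0 < cross x e ∧ cross x f < 0 ∧ 0 < cross y e ∧
    cross y f < 0) ∨ (cross x e < 0 ∧ 0 < cross x f ∧ cross y e < 0 ∧ 0 < cross y f))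
    (h : 0 ≤ dot x e / ‖e‖ + dot x f / ‖f‖) : 0 ≤ dot y e / ‖e‖ + dot y f / ‖f‖ := by
  have he : e ≠ 0 := by
    rintro rfl
    simp [cross] at h1
  have hf : f ≠ 0 := by
    rintro rfl
    simp [cross] at h1
  rcases h1 with ⟨h1, h2, h3, h4⟩ | ⟨h1, h2, h3, h4⟩
  · rwa [convex_iff he hf h3 h4, ← convex_iff he hf h1 h2]
  · rw [add_comm] at h ⊢
    rwa [convex_iff hf he h4 h3, ← convex_iff hf he h2 h1]

namespace IsStar

variable {ι : Type*} {σ : Equiv.Perm ι} {ε : ℝ} {h : ι → ℂ} {d : ℂ}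

lemma cross_ne_zero (hh : IsStar σ ε h) (hε : 0 < ε) (j : ι) : cross (h j) (h (σ j)) ≠ 0 := by
  intro h0
  have h1 : (h (σ j) / h j).im = 0 := by rw [div_im_eq, h0, zero_div]
  have h2 := hh.le_arg j
  have h3 := hh.arg_le j
  have h4 := Complex.sin_arg (h (σ j) / h j)
  rw [h1, zero_div] at h4
  have h5 := Real.abs_sin_eq_sin_abs_of_abs_le_pi (Complex.abs_arg_le_pi (h (σ j) / h j))
  rw [h4, abs_zero] at h5
  have := Real.sin_pos_of_pos_of_lt_pi (hε.trans_le h2) (h3.trans_lt (by linarith))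
  linarith

lemma arg_pos_iff (hh : IsStar σ ε h) (hε : 0 < ε) (j : ι) :
    0 < (h (σ j) / h j).arg ↔ 0 < cross (h j) (h (σ j)) := by
  have h0 := hh.cross_ne_zero hε j
  rw [arg_pos_iff_im, TriPlane.cross_pos_iff (hh.ne_zero j)]
  rw [div_im_eq]
  exact div_ne_zero h0 (pow_ne_zero _ (norm_ne_zero_iff.2 (hh.ne_zero j)))

lemma inv_sub_ne_zero (hh : IsStar σ ε h) (hε1 : ε ≤ 1) (hd : ∀ j, ‖d * h j‖ ≤ ε / 4) (j : ι) :
    (h j)⁻¹ - d ≠ 0 := by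
  intro h0
  apply one_sub_ne_zero hε1 (hd j)
  have : ((h j)⁻¹ - d) * h j = 0 := by rw [h0, zero_mul]
  rwa [sub_mul, inv_mul_cancel₀ (hh.ne_zero j)] at this

/-- Inversion with respect to a base point near the centre reverses the orientation. -/
lemma arg_inv_sub_sign (hh : IsStar σ ε h) (hε : 0 < ε) (hε1 : ε ≤ 1)
    (hd : ∀ j, ‖d * h j‖ ≤ ε / 4) (j : ι) :
    (0 < cross (h j) (h (σ j)) → 0 < -(((h (σ j))⁻¹ - d) / ((h j)⁻¹ - d)).arg) ∧
    (cross (h j) (h (σ j)) < 0 → 0 < (((h (σ j))⁻¹ - d) / ((h j)⁻¹ - d)).arg) := by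
  have e := arg_inv_sub_div hε hε1 (hh.ne_zero j) (hh.ne_zero (σ j)) (hh.arg_le j)
    (hd j) (hd (σ j))
  have g1 := abs_lt.1 (abs_arg_one_sub_lt hε hε1 (hd j))
  have g2 := abs_lt.1 (abs_arg_one_sub_lt hε hε1 (hd (σ j)))
  have h1 := hh.le_arg j
  constructor
  · intro hc
    rw [abs_of_pos ((hh.arg_pos_iff hε j).2 hc)] at h1
    linarith [g1.1, g1.2, g2.1, g2.2]
  · intro hc
    have : (h (σ j) / h j).arg ≤ 0 := by
      by_contra h2
      have := (hh.arg_pos_iff hε j).1 (not_le.1 h2)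
      linarith
    rw [abs_of_nonpos this] at h1
    linarith [g1.1, g1.2, g2.1, g2.2]

lemma cross_inv_sub (hh : IsStar σ ε h) (hε : 0 < ε) (hε1 : ε ≤ 1)
    (hd : ∀ j, ‖d * h j‖ ≤ ε / 4) (j : ι) :
    (0 < cross (h j) (h (σ j)) → cross ((h j)⁻¹ - d) ((h (σ j))⁻¹ - d) < 0) ∧
    (cross (h j) (h (σ j)) < 0 → 0 < cross ((h j)⁻¹ - d) ((h (σ j))⁻¹ - d)) := by
  have hn := hh.inv_sub_ne_zero hε1 hd j
  have hn2 : 0 < ‖(h j)⁻¹ - d‖ ^ 2 := by have := norm_pos_iff.2 hn; positivity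
  have e := arg_inv_sub_div hε hε1 (hh.ne_zero j) (hh.ne_zero (σ j)) (hh.arg_le j)
    (hd j) (hd (σ j))
  have g1 := abs_lt.1 (abs_arg_one_sub_lt hε hε1 (hd j))
  have g2 := abs_lt.1 (abs_arg_one_sub_lt hε hε1 (hd (σ j)))
  have g3 := abs_le.1 (hh.arg_le j)
  obtain ⟨k1, k2⟩ := hh.arg_inv_sub_sign hε hε1 hd j
  constructor
  · intro hc
    have := Complex.arg_neg_iff.1 (neg_pos.1 (k1 hc))
    rw [div_im_eq, div_neg_iff] at this
    rcases this with h | h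
    · linarith [h.2]
    · exact h.1
  · intro hc
    have h1 := k2 hc
    have h2 : 0 ≤ (((h (σ j))⁻¹ - d) / ((h j)⁻¹ - d)).im := Complex.arg_nonneg_iff.1 h1.le
    rw [div_im_eq, div_nonneg_iff] at h2
    have h3 : 0 ≤ cross ((h j)⁻¹ - d) ((h (σ j))⁻¹ - d) := by
      rcases h2 with h | h
      · exact h.1
      · linarith [h.2]
    refine lt_of_le_of_ne h3 fun h0 => ?_
    have h4 := Complex.sin_arg (((h (σ j))⁻¹ - d) / ((h j)⁻¹ - d))
    rw [div_im_eq, ← h0, zero_div, zero_div] at h4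
    have := Real.sin_pos_of_pos_of_lt_pi h1 (by
      rw [e]; linarith [g1.1, g1.2, g2.1, g2.2, g3.1, g3.2])
    linarith

/-- For base point 0 the triangles 0, a, b and 0, b⁻¹, a⁻¹ are similar, so the angle at b⁻¹ equals
the angle at a, and convexity of the inverted polygon is the Delaunay condition. Since 0 and d lie
on the same side of every polygon side, `convex_transfer` moves the base point to d. -/
lemma convex (hh : IsStar σ ε h) (hε : 0 < ε) (hε1 : ε ≤ 1) (hd : ∀ j, ‖d * h j‖ ≤ ε / 4) (j : ι) :
    0 ≤ dot ((h (σ j))⁻¹ - d) ((h (σ j))⁻¹ - (h j)⁻¹) / ‖(h (σ j))⁻¹ - (h j)⁻¹‖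
      + dot ((h (σ j))⁻¹ - d) ((h (σ j))⁻¹ - (h (σ (σ j)))⁻¹)
        / ‖(h (σ j))⁻¹ - (h (σ (σ j)))⁻¹‖ := by
  have hd0 : ∀ j, ‖(0 : ℂ) * h j‖ ≤ ε / 4 := fun j => by simp; linarith
  have x1 := hh.cross_inv_sub hε hε1 hd0 j
  have x2 := hh.cross_inv_sub hε hε1 hd0 (σ j)
  have y1 := hh.cross_inv_sub hε hε1 hd j
  have y2 := hh.cross_inv_sub hε hε1 hd (σ j)
  have hs := hh.cross_pos_iff j
  have n1 := hh.cross_ne_zero hε j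
  have n2 := hh.cross_ne_zero hε (σ j)
  have c1 : ∀ d : ℂ, cross ((h (σ j))⁻¹ - d) ((h (σ j))⁻¹ - (h j)⁻¹)
      = cross ((h j)⁻¹ - d) ((h (σ j))⁻¹ - d) := fun d => by
    simp only [cross, Complex.sub_re, Complex.sub_im]; ring
  have c2 : ∀ d : ℂ, cross ((h (σ j))⁻¹ - d) ((h (σ j))⁻¹ - (h (σ (σ j)))⁻¹)
      = -cross ((h (σ j))⁻¹ - d) ((h (σ (σ j)))⁻¹ - d) := fun d => by
    simp only [cross, Complex.sub_re, Complex.sub_im]; ring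
  refine convex_transfer (x := (h (σ j))⁻¹ - 0) ?_ ?_
  · rw [c1, c1, c2, c2]
    rcases lt_or_gt_of_ne n1 with hn | hn
    · have hn' : cross (h (σ j)) (h (σ (σ j))) < 0 :=
        lt_of_le_of_ne (not_lt.1 fun h => absurd (hs.2 h) (not_lt.2 hn.le)) n2
      left
      exact ⟨x1.2 hn, neg_lt_zero.2 (x2.2 hn'), y1.2 hn, neg_lt_zero.2 (y2.2 hn')⟩
    · have hn' := hs.1 hn
      right
      exact ⟨x1.1 hn, neg_pos.2 (x2.1 hn'), y1.1 hn, neg_pos.2 (y2.1 hn')⟩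
  · have key : ∀ a b : ℂ, a ≠ 0 → b ≠ 0 → dot (b⁻¹ - 0) (b⁻¹ - a⁻¹) / ‖b⁻¹ - a⁻¹‖
        = dot a (a - b) / (‖a‖ * ‖a - b‖) / ‖b‖ := by
      intro a b ha hb
      have hna := norm_pos_iff.2 ha
      have hnb := norm_pos_iff.2 hb
      rcases eq_or_ne a b with rfl | hab
      · simp
      have hnab := norm_pos_iff.2 (sub_ne_zero.2 hab)
      have e1 : b⁻¹ - a⁻¹ = (a - b) / (a * b) := by field_simp
      have e2 : dot (b⁻¹ - 0) (b⁻¹ - a⁻¹) = dot a (a - b) / (‖a‖ ^ 2 * ‖b‖ ^ 2) := by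
        have h1 := norm_sub_sq b⁻¹ (b⁻¹ - a⁻¹)
        have h2 := norm_sub_sq a (a - b)
        rw [sub_sub_cancel] at h1 h2
        rw [e1, norm_div, norm_mul, norm_inv, norm_inv] at h1
        have h3 : dot b⁻¹ ((a - b) / (a * b)) = (‖b‖⁻¹ ^ 2 + (‖a - b‖ / (‖a‖ * ‖b‖)) ^ 2 - ‖a‖⁻¹ ^ 2) / 2 := by
          linarith
        have h4 : dot a (a - b) = (‖a‖ ^ 2 + ‖a - b‖ ^ 2 - ‖b‖ ^ 2) / 2 := by linarith
        rw [sub_zero, e1, h3, h4]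
        field_simp
      rw [e2, e1, norm_div, norm_mul]
      field_simp
    rw [key _ _ (hh.ne_zero _) (hh.ne_zero _), key _ _ (hh.ne_zero _) (hh.ne_zero _), ← add_div]
    exact div_nonneg (hh.delaunay j) (norm_nonneg _)

/-- The orientation sign is constant along `σ`, so the corrections from `arg_inv_sub_div` telescope.
-/
lemma sum_abs_arg_inv_sub [Fintype ι] (hh : IsStar σ ε h) (hε : 0 < ε) (hε1 : ε ≤ 1)
    (hd : ∀ j, ‖d * h j‖ ≤ ε / 4) :
    ∑ j, |(((h (σ j))⁻¹ - d) / ((h j)⁻¹ - d)).arg| = ∑ j, |(h (σ j) / h j).arg| := by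
  classical
  let s : ι → ℝ := fun j => if 0 < cross (h j) (h (σ j)) then 1 else -1
  have hs : ∀ j, s (σ j) = s j := fun j => by simp only [s, hh.cross_pos_iff j]
  have e : ∀ j, |(((h (σ j))⁻¹ - d) / ((h j)⁻¹ - d)).arg|
      = |(h (σ j) / h j).arg| - (s (σ j) * (1 - d * h (σ j)).arg - s j * (1 - d * h j).arg) := by
    intro j
    obtain ⟨k1, k2⟩ := hh.arg_inv_sub_sign hε hε1 hd j
    have e := arg_inv_sub_div hε hε1 (hh.ne_zero j) (hh.ne_zero (σ j)) (hh.arg_le j)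
      (hd j) (hd (σ j))
    rw [hs j]
    by_cases hc : 0 < cross (h j) (h (σ j))
    · rw [abs_of_neg (neg_pos.1 (k1 hc)), abs_of_pos ((hh.arg_pos_iff hε j).2 hc), e]
      simp only [s, if_pos hc]
      ring
    · have hc' := lt_of_le_of_ne (not_lt.1 hc) (hh.cross_ne_zero hε j)
      have : (h (σ j) / h j).arg ≤ 0 := not_lt.1 fun h2 => hc ((hh.arg_pos_iff hε j).1 h2)
      rw [abs_of_pos (k2 hc'), abs_of_nonpos this, e]
      simp only [s, if_neg hc]
      ring
  simp only [e]
  rw [Finset.sum_sub_distrib, Finset.sum_sub_distrib,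
    Equiv.sum_comp σ fun j => s j * (1 - d * h j).arg, sub_self, sub_zero]

/-- The total angle at the centre of a star is at least `2 * π`. -/
lemma two_pi_le_sum_abs_arg [Fintype ι] [Nonempty ι] (hh : IsStar σ ε h) (hε : 0 < ε) :
    2 * Real.pi ≤ ∑ j, |(h (σ j) / h j).arg| := by
  classical
  let s : ι → ℤ := fun j => if 0 < cross (h j) (h (σ j)) then 1 else -1
  have hs : ∀ j, s (σ j) = s j := fun j => by simp only [s, hh.cross_pos_iff j]
  have e : ∀ j, |(h (σ j) / h j).arg| = s j • (h (σ j) / h j).arg := by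
    intro j
    by_cases hc : 0 < cross (h j) (h (σ j))
    · rw [abs_of_pos ((hh.arg_pos_iff hε j).2 hc)]
      simp only [s, if_pos hc, one_zsmul]
    · have : (h (σ j) / h j).arg ≤ 0 := not_lt.1 fun h2 => hc ((hh.arg_pos_iff hε j).1 h2)
      rw [abs_of_nonpos this]
      simp only [s, if_neg hc, neg_smul, one_zsmul]
  -- Modulo 2π the signed angles are differences of arguments and cancel along `σ`; the positive sum
  -- is therefore a positive multiple of 2π.
  have hA : ((∑ j, |(h (σ j) / h j).arg| : ℝ) : Real.Angle) = 0 := by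
    have h1 : ((∑ j, |(h (σ j) / h j).arg| : ℝ) : Real.Angle)
        = ∑ j, ((|(h (σ j) / h j).arg| : ℝ) : Real.Angle) :=
      map_sum Real.Angle.coeHom _ _
    rw [h1]
    have h2 : ∀ j, ((|(h (σ j) / h j).arg| : ℝ) : Real.Angle)
        = s (σ j) • ((h (σ j)).arg : Real.Angle) - s j • ((h j).arg : Real.Angle) := by
      intro j
      rw [e, Real.Angle.coe_zsmul, Complex.arg_div_coe_angle (hh.ne_zero _) (hh.ne_zero _), hs,
        smul_sub]
    simp only [h2]
    rw [Finset.sum_sub_distrib, Equiv.sum_comp σ fun j => s j • ((h j).arg : Real.Angle), sub_self]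
  obtain ⟨n, hn⟩ := Real.Angle.coe_eq_zero_iff.1 hA
  have hpos : 0 < ∑ j, |(h (σ j) / h j).arg| :=
    Finset.sum_pos (fun j _ => hε.trans_le (hh.le_arg j)) Finset.univ_nonempty
  rw [← hn, zsmul_eq_mul] at hpos ⊢
  have hn0 : (0 : ℝ) < n := (pos_iff_pos_of_mul_pos hpos).2 Real.two_pi_pos
  have : (1 : ℝ) ≤ n := by exact_mod_cast (by exact_mod_cast hn0 : 0 < n)
  nlinarith [Real.two_pi_pos]

end IsStar

/-! ### Disjoint sectors around a point -/

lemma exists_lift_of_mem_ball {T : ℝ} {x r : ℝ} {θ : AddCircle T}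
    (hθ : θ ∈ Metric.ball (x : AddCircle T) r) : ∃ y : ℝ, (y : AddCircle T) = θ ∧ |y - x| < r := by
  obtain ⟨y, rfl⟩ := QuotientAddGroup.mk_surjective θ
  rw [Metric.mem_ball, dist_eq_norm] at hθ
  have h1 : ((y : AddCircle T) - (x : AddCircle T)) = ((y - x : ℝ) : AddCircle T) := rfl
  have h2 : ‖((y - x : ℝ) : AddCircle T)‖ < r := by rw [← h1]; exact hθ
  rw [AddCircle.norm_eq] at h2
  refine ⟨y - round (T⁻¹ * (y - x)) * T, ?_, by convert h2 using 2; ring⟩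
  have : (round (T⁻¹ * (y - x)) * T : ℝ) = round (T⁻¹ * (y - x)) • T := by rw [zsmul_eq_mul]
  rw [AddCircle.coe_sub, this, AddCircle.coe_zsmul, AddCircle.coe_period]
  simp

/-- The coefficients come from sin α · e^{iψ} = sin(α - ψ) + sin ψ · e^{iα}, all three sines being
positive for 0 < ψ < α < π. -/
lemma exp_mem_sector {a b : ℂ} (ha : a ≠ 0) (hb : b ≠ 0) (hpos : 0 < (b / a).arg)
    (hpi : (b / a).arg < Real.pi) {y : ℝ} (h1 : a.arg < y) (h2 : y < a.arg + (b / a).arg) :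
    ∃ s t : ℝ, 0 < s ∧ 0 < t ∧ Complex.exp (y * Complex.I) = s * a + t * b := by
  set α := (b / a).arg with hα
  set ψ := y - a.arg with hψ
  have hsα : 0 < Real.sin α := Real.sin_pos_of_pos_of_lt_pi hpos hpi
  have hs1 : 0 < Real.sin (α - ψ) := Real.sin_pos_of_pos_of_lt_pi (by linarith) (by linarith)
  have hs2 : 0 < Real.sin ψ := Real.sin_pos_of_pos_of_lt_pi (by linarith) (by linarith)
  have hna := norm_pos_iff.2 ha
  have hnb := norm_pos_iff.2 hb
  refine ⟨Real.sin (α - ψ) / Real.sin α / ‖a‖, Real.sin ψ / Real.sin α / ‖b‖, by positivity,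
    by positivity, ?_⟩
  have ea : a = ‖a‖ * Complex.exp (a.arg * Complex.I) := (Complex.norm_mul_exp_arg_mul_I a).symm
  have eb : b = ‖b‖ * Complex.exp (a.arg * Complex.I) * Complex.exp (α * Complex.I) := by
    have h3 : b / a = ‖b / a‖ * Complex.exp (α * Complex.I) :=
      (Complex.norm_mul_exp_arg_mul_I _).symm
    rw [norm_div] at h3
    have h4 : b = (b / a) * a := by field_simp
    have hna' : (‖a‖ : ℂ) ≠ 0 := by exact_mod_cast hna.ne'
    rw [h3] at h4
    refine h4.trans ?_
    nth_rewrite 2 [ea]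
    push_cast
    generalize Complex.exp (a.arg * Complex.I) = e
    generalize Complex.exp (α * Complex.I) = f
    field_simp
  have ey : Complex.exp (y * Complex.I)
      = Complex.exp (a.arg * Complex.I) * Complex.exp (ψ * Complex.I) := by
    rw [← Complex.exp_add]
    congr 1
    rw [hψ]
    push_cast
    ring
  have hna' : (‖a‖ : ℂ) ≠ 0 := by exact_mod_cast hna.ne'
  have hnb' : (‖b‖ : ℂ) ≠ 0 := by exact_mod_cast hnb.ne'
  have hsα' : (Real.sin α : ℂ) ≠ 0 := by exact_mod_cast hsα.ne'
  have key : (Real.sin α : ℂ) * Complex.exp (ψ * Complex.I)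
      = Real.sin (α - ψ) + Real.sin ψ * Complex.exp (α * Complex.I) := by
    rw [Complex.exp_mul_I, Complex.exp_mul_I, Real.sin_sub]
    push_cast
    ring
  have e1 : ((Real.sin (α - ψ) / Real.sin α / ‖a‖ : ℝ) : ℂ) * a
      = Real.sin (α - ψ) / Real.sin α * Complex.exp (a.arg * Complex.I) := by
    nth_rewrite 2 [ea]
    push_cast
    field_simp
  have e2 : ((Real.sin ψ / Real.sin α / ‖b‖ : ℝ) : ℂ) * b
      = Real.sin ψ / Real.sin α * Complex.exp (a.arg * Complex.I) * Complex.exp (α * Complex.I) := by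
    nth_rewrite 2 [eb]
    push_cast
    field_simp
  rw [e1, e2, ey]
  generalize Complex.exp (a.arg * Complex.I) = e at *
  generalize Complex.exp (α * Complex.I) = f at *
  generalize Complex.exp (ψ * Complex.I) = g at *
  field_simp
  linear_combination e * key

open MeasureTheory in
/-- Disjoint sectors at a point have total angle at most `2 * π`. -/
lemma sum_arg_le_two_pi {ι : Type*} [Fintype ι] {h k : ι → ℂ} (hh : ∀ j, h j ≠ 0)
    (hk : ∀ j, k j ≠ 0) (hpos : ∀ j, 0 < (k j / h j).arg) (hpi : ∀ j, (k j / h j).arg < Real.pi)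
    (hdisj : ∀ i j, i ≠ j → ∀ s t s' t' : ℝ, 0 < s → 0 < t → 0 < s' → 0 < t' →
      (s * h i + t * k i : ℂ) ≠ s' * h j + t' * k j) :
    ∑ j, (k j / h j).arg ≤ 2 * Real.pi := by
  have : Fact (0 < 2 * Real.pi) := ⟨Real.two_pi_pos⟩
  -- The directions of a sector form an open arc, that is, a ball around the bisector in the circle
  -- of length 2π. Disjoint arcs have total length at most 2π.
  let B : ι → Set (AddCircle (2 * Real.pi)) := fun j =>
    Metric.ball (((h j).arg + (k j / h j).arg / 2 : ℝ) : AddCircle (2 * Real.pi))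
      ((k j / h j).arg / 2)
  have hB : ∀ j, volume (B j) = ENNReal.ofReal (k j / h j).arg := by
    intro j
    simp only [B]
    rw [← measure_congr AddCircle.closedBall_ae_eq_ball, AddCircle.volume_closedBall,
      min_eq_right (by linarith [hpi j, Real.pi_pos])]
    congr 1
    ring
  have hd : Pairwise (Function.onFun Disjoint B) := by
    intro i j hij
    rw [Function.onFun, Set.disjoint_left]
    intro θ hi hj
    obtain ⟨y, hy, hyl⟩ := exists_lift_of_mem_ball hi
    obtain ⟨z, hz, hzl⟩ := exists_lift_of_mem_ball hj
    rw [abs_lt] at hyl hzl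
    obtain ⟨s, t, hs, ht, he⟩ := exp_mem_sector (hh i) (hk i) (hpos i) (hpi i) (y := y)
      (by linarith [hyl.1]) (by linarith [hyl.2])
    obtain ⟨s', t', hs', ht', he'⟩ := exp_mem_sector (hh j) (hk j) (hpos j) (hpi j) (y := z)
      (by linarith [hzl.1]) (by linarith [hzl.2])
    refine hdisj i j hij s t s' t' hs ht hs' ht' ?_
    rw [← he, ← he']
    have hyz : (y : Real.Angle) = (z : Real.Angle) := hy.trans hz.symm
    obtain ⟨n, hn⟩ := Real.Angle.angle_eq_iff_two_pi_dvd_sub.1 hyz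
    rw [Complex.exp_eq_exp_iff_exists_int]
    refine ⟨n, ?_⟩
    have : y = z + 2 * Real.pi * n := by linarith
    rw [this]
    push_cast
    ring
  have h1 : volume (⋃ j, B j) = ∑ j, volume (B j) := by
    rw [measure_iUnion hd fun j => Metric.isOpen_ball.measurableSet, tsum_fintype]
  have h2 : volume (⋃ j, B j) ≤ ENNReal.ofReal (2 * Real.pi) := by
    rw [← AddCircle.measure_univ]
    exact measure_mono (Set.subset_univ _)
  rw [h1] at h2
  simp only [hB] at h2
  rw [← ENNReal.ofReal_sum_of_nonneg fun j _ => (hpos j).le] at h2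
  exact (ENNReal.ofReal_le_ofReal_iff Real.two_pi_pos.le).1 h2

/-! ### Comparison of two inverted stars -/

/-- Two stars whose inversions have the same side lengths: the inversions cannot be strictly closer
to the base point in one of them. -/
lemma IsStar.exists_norm_le {ι : Type*} [Fintype ι] [Nonempty ι] {σ : Equiv.Perm ι} {ε : ℝ}
    {h h' : ι → ℂ} (hh : IsStar σ ε h) (hh' : IsStar σ ε h') (hε : 0 < ε) (hε1 : ε ≤ 1)
    (hsum : ∑ j, |(h' (σ j) / h' j).arg| ≤ 2 * Real.pi)
    (hedge : ∀ j, ‖(h (σ j))⁻¹ - (h j)⁻¹‖ = ‖(h' (σ j))⁻¹ - (h' j)⁻¹‖)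
    {d d' : ℂ} (hd : ∀ j, ‖d * h j‖ ≤ ε / 4) (hd' : ∀ j, ‖d' * h' j‖ ≤ ε / 4) :
    ∃ j, ‖(h j)⁻¹ - d‖ ≤ ‖(h' j)⁻¹ - d'‖ := by
  by_contra hn
  push Not at hn
  have aux : ∀ {g : ι → ℂ} {b : ℂ}, IsStar σ ε g → (∀ j, ‖b * g j‖ ≤ ε / 4) →
      (∀ j, cross ((g j)⁻¹ - b) ((g (σ j))⁻¹ - b) ≠ 0) ∧
      (∀ j, 0 < heron ‖(g (σ j))⁻¹ - (g j)⁻¹‖ (‖(g j)⁻¹ - b‖ ^ 2) (‖(g (σ j))⁻¹ - b‖ ^ 2)) ∧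
      (∀ j, 0 ≤ (‖(g (σ j))⁻¹ - b‖ ^ 2 + ‖(g (σ j))⁻¹ - (g j)⁻¹‖ ^ 2 - ‖(g j)⁻¹ - b‖ ^ 2)
          / ‖(g (σ j))⁻¹ - (g j)⁻¹‖
        + (‖(g (σ j))⁻¹ - b‖ ^ 2 + ‖(g (σ (σ j)))⁻¹ - (g (σ j))⁻¹‖ ^ 2
            - ‖(g (σ (σ j)))⁻¹ - b‖ ^ 2) / ‖(g (σ (σ j)))⁻¹ - (g (σ j))⁻¹‖) ∧
      ∑ j, apexAngle ‖(g (σ j))⁻¹ - (g j)⁻¹‖ (‖(g j)⁻¹ - b‖ ^ 2) (‖(g (σ j))⁻¹ - b‖ ^ 2)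
        = ∑ j, |(g (σ j) / g j).arg| := by
    intro g b hg hb
    have hc : ∀ j, cross ((g j)⁻¹ - b) ((g (σ j))⁻¹ - b) ≠ 0 := by
      intro j
      obtain ⟨k1, k2⟩ := hg.cross_inv_sub hε hε1 hb j
      rcases lt_or_gt_of_ne (hg.cross_ne_zero hε j) with h | h
      · exact (k2 h).ne'
      · exact (k1 h).ne
    have hs : ∀ x y : ℂ, ‖y - x‖ = ‖(y - b) - (x - b)‖ := fun x y => by rw [sub_sub_sub_cancel_right]
    refine ⟨hc, fun j => ?_, fun j => ?_, ?_⟩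
    · rw [hs, heron_norm]
      have := hc j
      positivity
    · have hcv := hg.convex hε hε1 hb j
      have e : ∀ x y : ℂ, ‖x - b‖ ^ 2 + ‖x - y‖ ^ 2 - ‖y - b‖ ^ 2 = 2 * dot (x - b) (x - y) := by
        intro x y
        rw [← dot_self, ← dot_self, ← dot_self]
        simp only [dot, Complex.sub_re, Complex.sub_im]
        ring
      rw [e, norm_sub_rev (g (σ (σ j)))⁻¹, e, mul_div_assoc, mul_div_assoc]
      linarith
    · rw [← hg.sum_abs_arg_inv_sub hε hε1 hb]
      refine Finset.sum_congr rfl fun j _ => ?_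
      rw [hs, apexAngle_norm (hc j)]
  obtain ⟨c1, a1, a2, a3⟩ := aux hh hd
  obtain ⟨c1', b1, b2, b3⟩ := aux hh' hd'
  have hpos : ∀ j, 0 < ‖(h' (σ j))⁻¹ - (h' j)⁻¹‖ := by
    intro j
    refine norm_pos_iff.2 fun h0 => c1' j ?_
    rw [sub_eq_zero.1 h0]
    simp only [cross]
    ring
  -- If all distances for `h` are strictly larger, its total angle is strictly smaller than that of
  -- `h'`, hence below 2π; this contradicts `two_pi_le_sum_abs_arg`.
  have := sum_apexAngle_lt σ (c := fun j => ‖(h' (σ j))⁻¹ - (h' j)⁻¹‖)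
    (ρ := fun j => ‖(h j)⁻¹ - d‖ ^ 2) (ρ' := fun j => ‖(h' j)⁻¹ - d'‖ ^ 2) hpos
    (fun j => by simpa only [hedge] using a1 j) b1 (fun j => by simpa only [hedge] using a2 j) b2
    (fun j => by have := norm_pos_iff.2 (hh'.inv_sub_ne_zero hε1 hd' j); positivity)
    (fun j => by have := hn j; gcongr)
  rw [b3] at this
  simp only [hedge] at a3
  rw [a3] at this
  linarith [hh.two_pi_le_sum_abs_arg hε]

/-! ### Angles, sectors and triangles of a geodesic embedding -/

lemma cos_angle_eq (a b : ℂ) :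
    Real.cos (InnerProductGeometry.angle a b) = dot a b / (‖a‖ * ‖b‖) := by
  rw [InnerProductGeometry.cos_angle]
  congr 1
  rw [Complex.inner, dot]
  simp
  ring

lemma cos_add_cos_nonneg {a b : ℝ} (ha0 : 0 ≤ a) (hb0 : 0 ≤ b)
    (h : a + b ≤ Real.pi) : 0 ≤ Real.cos a + Real.cos b := by
  have := Real.cos_le_cos_of_nonneg_of_le_pi ha0 (by linarith : Real.pi - b ≤ Real.pi) (by linarith)
  rw [Real.cos_pi_sub] at this
  linarith

/-- Two sectors on the same side of a common ray overlap: choose t, t' to match the components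
transverse to a, then compensate along a, with 1 + |l| added to keep both coefficients positive. -/
lemma exists_common_of_cross_pos {a b c : ℂ} (h : 0 < cross a b * cross a c) :
    ∃ s t s' t' : ℝ, 0 < s ∧ 0 < t ∧ 0 < s' ∧ 0 < t' ∧
      (s * a + t * b : ℂ) = s' * a + t' * c := by
  have ha : a ≠ 0 := fun h0 => by simp [h0, cross] at h
  have hn : ‖a‖ ^ 2 ≠ 0 := pow_ne_zero _ (norm_ne_zero_iff.2 ha)
  have key : ∀ t t' : ℝ, t * cross a b = t' * cross a c → 0 < t → 0 < t' →
      ∃ s t s' t' : ℝ, 0 < s ∧ 0 < t ∧ 0 < s' ∧ 0 < t' ∧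
      (s * a + t * b : ℂ) = s' * a + t' * c := by
    intro t t' htt ht ht'
    let l : ℝ := dot a (t * b - t' * c) / ‖a‖ ^ 2
    have hl : (l * a : ℂ) = t * b - t' * c := by
      have h1 : l * ‖a‖ ^ 2 = dot a (t * b - t' * c) := div_mul_cancel₀ _ hn
      have h2 : (l * a - (t * b - t' * c) : ℂ) * (starRingEnd ℂ) a = 0 := by
        rw [← dot_self] at h1
        apply Complex.ext
        · simp [dot] at h1 ⊢; linear_combination h1
        · simp [cross] at htt ⊢; linear_combination -htt
      rcases mul_eq_zero.1 h2 with h3 | h3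
      · exact sub_eq_zero.1 h3
      · exact absurd h3 (by simpa using ha)
    refine ⟨1 + |l|, t, 1 + |l| + l, t', by positivity, ht, ?_, ht', ?_⟩
    · have := neg_abs_le l; linarith
    · push_cast
      linear_combination -hl
  rcases mul_pos_iff.1 h with ⟨h1, h2⟩ | ⟨h1, h2⟩
  · exact key (cross a c) (cross a b) (by ring) h2 h1
  · exact key (-cross a c) (-cross a b) (by ring) (by linarith) (by linarith)

section

variable {V : Type*} [DecidableEq V] {T : AbstractSimplicialComplex V} {φ : Space T → ℂ}
  {i j k m n : V} {ε : ℝ}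

lemma vertex_injective : Function.Injective (vertex T) := by
  intro i j h
  have := congrArg (fun x : Space T => (x : V → ℝ) i) h
  simp only [vertex_apply, if_true] at this
  by_contra hij
  simp [hij] at this

lemma cornerAngle_eq_angle (φ : Space T → ℂ) (i j k : V) :
    cornerAngle (inducedMetric T φ) i j k = InnerProductGeometry.angle
      (φ (vertex T j) - φ (vertex T i)) (φ (vertex T k) - φ (vertex T i)) := by
  rw [← Real.arccos_cos (InnerProductGeometry.angle_nonneg _ _)
    (InnerProductGeometry.angle_le_pi _ _), cos_angle_eq, cornerAngle]
  congr 1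
  simp only [inducedMetric, dist_eq_norm]
  set a := φ (vertex T j) - φ (vertex T i)
  set b := φ (vertex T k) - φ (vertex T i)
  have h1 : φ (vertex T j) - φ (vertex T k) = a - b := by simp only [a, b]; ring
  rw [h1, norm_sub_rev (φ (vertex T i)), norm_sub_rev (φ (vertex T i)), norm_sub_sq a b,
    show ‖a‖ ^ 2 + ‖b‖ ^ 2 - (‖a‖ ^ 2 + ‖b‖ ^ 2 - 2 * dot a b) = 2 * dot a b by ring,
    mul_assoc, mul_div_mul_left _ _ two_ne_zero]

namespace IsGeodesicEmbedding

lemma sub_ne_zero_of_ne (hφ : IsGeodesicEmbedding T φ) (h : i ≠ j) :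
    φ (vertex T j) - φ (vertex T i) ≠ 0 :=
  sub_ne_zero.2 fun h0 => h (vertex_injective (hφ.isEmbedding.injective h0)).symm

lemma cornerAngle_eq_abs_arg (hφ : IsGeodesicEmbedding T φ) (h : IsTriangle T i j k) :
    cornerAngle (inducedMetric T φ) i j k = |((φ (vertex T k) - φ (vertex T i)) /
      (φ (vertex T j) - φ (vertex T i))).arg| := by
  rw [cornerAngle_eq_angle, InnerProductGeometry.angle_comm,
    Complex.angle_eq_abs_arg (hφ.sub_ne_zero_of_ne h.2.2.1) (hφ.sub_ne_zero_of_ne h.1)]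

lemma cornerAngle_le (hφ : IsGeodesicEmbedding T φ) (hε : 0 < ε)
    (hnd : UniformlyNondegenerate T (inducedMetric T φ) ε) (h : IsTriangle T i j k) :
    cornerAngle (inducedMetric T φ) i j k ≤ Real.pi - ε := by
  have h1 := hnd j k i h.rotate
  have h2 := hnd k i j h.rotate.rotate
  have h3 := EuclideanGeometry.angle_add_angle_add_angle_eq_pi (p₁ := φ (vertex T j))
    (p₂ := φ (vertex T i)) (φ (vertex T k)) (sub_ne_zero.1 (hφ.sub_ne_zero_of_ne h.1.symm))
  simp only [EuclideanGeometry.angle, vsub_eq_sub] at h3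
  rw [cornerAngle_eq_angle] at h1 h2 ⊢
  linarith

lemma cross_ne_zero (hφ : IsGeodesicEmbedding T φ) (hε : 0 < ε)
    (hnd : UniformlyNondegenerate T (inducedMetric T φ) ε) (h : IsTriangle T i j k) :
    cross (φ (vertex T j) - φ (vertex T i)) (φ (vertex T k) - φ (vertex T i)) ≠ 0 := by
  intro h0
  have h2 := hnd i j k h
  have h3 := hφ.cornerAngle_le hε hnd h
  rw [hφ.cornerAngle_eq_abs_arg h] at h2 h3
  have h4 := Complex.sin_arg ((φ (vertex T k) - φ (vertex T i)) /
      (φ (vertex T j) - φ (vertex T i)))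
  rw [div_im_eq, h0, zero_div, zero_div] at h4
  have h5 := Real.abs_sin_eq_sin_abs_of_abs_le_pi (Complex.abs_arg_le_pi
    ((φ (vertex T k) - φ (vertex T i)) / (φ (vertex T j) - φ (vertex T i))))
  rw [h4, abs_zero] at h5
  have := Real.sin_pos_of_pos_of_lt_pi (hε.trans_le h2) (h3.trans_lt (by linarith))
  linarith

/-- The law of sines bounds the ratio of two sides of a triangle. -/
lemma sin_mul_le (hφ : IsGeodesicEmbedding T φ) (hε : 0 < ε)
    (hnd : UniformlyNondegenerate T (inducedMetric T φ) ε) (h : IsTriangle T i j k) :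
    Real.sin ε * inducedMetric T φ i j ≤ inducedMetric T φ j k := by
  have h1 := hnd i j k h
  have h2 := hφ.cornerAngle_le hε hnd h
  have h3 := EuclideanGeometry.law_sin (φ (vertex T i)) (φ (vertex T k)) (φ (vertex T j))
  rw [cornerAngle_eq_angle] at h1 h2
  have h4 : Real.sin ε ≤ Real.sin (EuclideanGeometry.angle (φ (vertex T j)) (φ (vertex T i))
      (φ (vertex T k))) := by
    have : EuclideanGeometry.angle (φ (vertex T j)) (φ (vertex T i)) (φ (vertex T k))
        = InnerProductGeometry.angle (φ (vertex T j) - φ (vertex T i))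
          (φ (vertex T k) - φ (vertex T i)) := rfl
    rw [this]
    set θ := InnerProductGeometry.angle (φ (vertex T j) - φ (vertex T i))
          (φ (vertex T k) - φ (vertex T i))
    rcases le_total θ (Real.pi / 2) with h5 | h5
    · exact Real.sin_le_sin_of_le_of_le_pi_div_two (by linarith [Real.pi_pos]) h5 h1
    · rw [← Real.sin_pi_sub θ]
      exact Real.sin_le_sin_of_le_of_le_pi_div_two (by linarith [Real.pi_pos]) (by linarith)
        (by linarith)
  have h6 : Real.sin ε * dist (φ (vertex T j)) (φ (vertex T i))
      ≤ dist (φ (vertex T k)) (φ (vertex T j)) :=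
    calc _ ≤ _ := mul_le_mul_of_nonneg_right h4 dist_nonneg
      _ = _ := h3.symm
      _ ≤ 1 * _ := mul_le_mul_of_nonneg_right (Real.sin_le_one _) dist_nonneg
      _ = _ := one_mul _
  rwa [dist_comm, dist_comm (φ (vertex T k))] at h6

/-- The open sectors at `i` of two different triangles are disjoint. -/
lemma eq_or_eq_of_mem_sectors (hφ : IsGeodesicEmbedding T φ) (hε : 0 < ε)
    (hnd : UniformlyNondegenerate T (inducedMetric T φ) ε) (h : IsTriangle T i j k)
    (h' : IsTriangle T i m n) {s t s' t' : ℝ} (hs : 0 < s) (ht : 0 < t) (hs' : 0 < s')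
    (ht' : 0 < t') (he : (s * (φ (vertex T j) - φ (vertex T i)) +
      t * (φ (vertex T k) - φ (vertex T i)) : ℂ) = s' * (φ (vertex T m) - φ (vertex T i)) +
      t' * (φ (vertex T n) - φ (vertex T i))) :
    (j = m ∧ k = n) ∨ (j = n ∧ k = m) := by
  have hc := hφ.cross_ne_zero hε hnd h
  -- The common vector is shrunk until it lies in both open triangles, so that injectivity
  -- identifies the two preimages.
  let η : ℝ := 1 / (s + t + s' + t' + 1)
  have hη : 0 < η := by positivity
  have hη1 : η * (s + t) < 1 := by
    simp only [η]; rw [one_div_mul_eq_div, div_lt_one (by positivity)]; linarith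
  have hη2 : η * (s' + t') < 1 := by
    simp only [η]; rw [one_div_mul_eq_div, div_lt_one (by positivity)]; linarith
  obtain ⟨x, hx, hxe⟩ := hφ.exists_mem_triangle h hc (mul_pos hη hs) (mul_pos hη ht)
    (by linarith)
  obtain ⟨y, hy, hye⟩ := hφ.exists_mem_triangle h' (hφ.cross_ne_zero hε hnd h') (mul_pos hη hs')
    (mul_pos hη ht') (by linarith)
  have hxy : x = y := by
    apply hφ.isEmbedding.injective
    rw [hxe, hye]
    push_cast
    linear_combination η * he
  subst hxy
  -- If the coordinate at `a` vanished, the point would lie on the edge `ib`, and its image on the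
  -- line through that edge, forcing p = 0.
  have key : ∀ {a b : V} {p q : ℝ}, IsTriangle T i a b → 0 < p →
      (∀ v, v ≠ i → v ≠ a → v ≠ b → (x : V → ℝ) v = 0) →
      φ x = φ (vertex T i) + p * (φ (vertex T a) - φ (vertex T i))
        + q * (φ (vertex T b) - φ (vertex T i)) → (x : V → ℝ) a ≠ 0 := by
    intro a b p q hab hp hx hxe h0
    have hmem := hφ.mem_segment hab.swap.edge (x := x) fun v h1 h2 => by
      by_cases h3 : v = a
      · rw [h3, h0]
      · exact hx v h1 h3 h2
    obtain ⟨c, d, -, -, hcd, hxs⟩ := hmem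
    apply hφ.cross_ne_zero hε hnd hab
    have h2 : cross (φ x - φ (vertex T i)) (φ (vertex T b) - φ (vertex T i)) = 0 := by
      have : φ x - φ (vertex T i) = d * (φ (vertex T b) - φ (vertex T i)) := by
        rw [← hxs, Complex.real_smul, Complex.real_smul]
        have : (c : ℂ) + d = 1 := by exact_mod_cast hcd
        linear_combination φ (vertex T i) * this
      rw [this]
      simp [cross]
      ring
    have h3 : cross (φ x - φ (vertex T i)) (φ (vertex T b) - φ (vertex T i))
        = p * cross (φ (vertex T a) - φ (vertex T i)) (φ (vertex T b) - φ (vertex T i)) := by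
      rw [hxe]
      simp [cross]
      ring
    rw [h3] at h2
    exact (mul_eq_zero.1 h2).resolve_left hp.ne'
  have hj := key h (mul_pos hη hs) hx hxe
  have hk := key h.swap (mul_pos hη ht) (fun v h1 h2 h3 => hx v h1 h3 h2) (by rw [hxe]; ring)
  have hj' : j = m ∨ j = n := by
    by_contra hn
    push Not at hn
    exact hj (hy j h.1.symm hn.1 hn.2)
  have hk' : k = m ∨ k = n := by
    by_contra hn
    push Not at hn
    exact hk (hy k h.2.2.1.symm hn.1 hn.2)
  have hjk := h.2.1
  rcases hj' with rfl | rfl <;> rcases hk' with rfl | rfl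
  · exact absurd rfl hjk
  · exact Or.inl ⟨rfl, rfl⟩
  · exact Or.inr ⟨rfl, rfl⟩
  · exact absurd rfl hjk

/-- There is at most one triangle on each side of an edge. -/
lemma eq_of_same_side (hφ : IsGeodesicEmbedding T φ) (hε : 0 < ε)
    (hnd : UniformlyNondegenerate T (inducedMetric T φ) ε) (h : IsTriangle T i j k)
    (h' : IsTriangle T i j m)
    (hc : 0 < cross (φ (vertex T j) - φ (vertex T i)) (φ (vertex T k) - φ (vertex T i)) *
      cross (φ (vertex T j) - φ (vertex T i)) (φ (vertex T m) - φ (vertex T i))) : k = m := by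
  obtain ⟨s, t, s', t', hs, ht, hs', ht', he⟩ := exists_common_of_cross_pos hc
  rcases hφ.eq_or_eq_of_mem_sectors hε hnd h h' hs ht hs' ht' he with h1 | h1
  · exact h1.2
  · exact absurd h1.1 h'.2.1

lemma exists_mem_edge (hφ : IsGeodesicEmbedding T φ) (he : IsEdge T i j) {t : ℝ} (h0 : 0 < t)
    (h1 : t < 1) : ∃ x : Space T, φ x = φ (vertex T i) + t * (φ (vertex T j) - φ (vertex T i)) ∧
      0 < (x : V → ℝ) i ∧ 0 < (x : V → ℝ) j := by
  have hmem : φ (vertex T i) + t * (φ (vertex T j) - φ (vertex T i)) ∈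
      segment ℝ (φ (vertex T i)) (φ (vertex T j)) :=
    ⟨1 - t, t, by linarith, h0.le, by ring, by
      rw [Complex.real_smul, Complex.real_smul]; push_cast; ring⟩
  have hne := hφ.sub_ne_zero_of_ne he.1
  rw [← hφ.image_edge i j he] at hmem
  obtain ⟨x, hx, hxe⟩ := hmem
  refine ⟨x, hxe, lt_of_le_of_ne (nonneg_apply x i) fun h2 => ?_,
    lt_of_le_of_ne (nonneg_apply x j) fun h2 => ?_⟩
  · have : x = vertex T j := eq_vertex_of_forall_ne x fun v hv => by
      by_cases hvi : v = i
      · rw [hvi, h2]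
      · exact hx v hvi hv
    rw [this] at hxe
    have h3 : ((1 - t : ℝ) : ℂ) * (φ (vertex T j) - φ (vertex T i)) = 0 := by
      push_cast; linear_combination hxe
    rcases mul_eq_zero.1 h3 with h4 | h4
    · have : 1 - t = 0 := by exact_mod_cast h4
      linarith
    · exact hne h4
  · have : x = vertex T i := eq_vertex_of_forall_ne x fun v hv => by
      by_cases hvi : v = j
      · rw [hvi, h2]
      · exact hx v hv hvi
    rw [this] at hxe
    have h3 : (t : ℂ) * (φ (vertex T j) - φ (vertex T i)) = 0 := by
      linear_combination -hxe
    rcases mul_eq_zero.1 h3 with h4 | h4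
    · have : t = 0 := by exact_mod_cast h4
      linarith
    · exact hne h4

/-- A vertex whose image is interior to the image of `φ` has a neighbour. -/
lemma exists_edge (hφ : IsGeodesicEmbedding T φ)
    (hr : Set.range φ ∈ nhds (φ (vertex T i))) : ∃ j, IsEdge T i j := by
  obtain ⟨O, hO, hOe⟩ := hφ.isEmbedding.isOpen_iff.1 (isOpen_pos (T := T) i)
  have hi : φ (vertex T i) ∈ O := by
    have : vertex T i ∈ φ ⁻¹' O := by rw [hOe]; simp [vertex_apply]
    exact this
  obtain ⟨δ, hδ, hb⟩ := Metric.mem_nhds_iff.1 (Filter.inter_mem hr (hO.mem_nhds hi))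
  obtain ⟨⟨y, hy⟩, hyO⟩ := @hb (φ (vertex T i) + (δ / 2 : ℝ)) (by
    rw [Metric.mem_ball, dist_eq_norm, add_sub_cancel_left, Complex.norm_real, Real.norm_eq_abs,
      abs_of_pos (by linarith)]
    linarith)
  have hyi : 0 < (y : V → ℝ) i := by
    have : y ∈ φ ⁻¹' O := by rw [Set.mem_preimage, hy]; exact hyO
    rw [hOe] at this
    exact this
  obtain ⟨j, hji, hj⟩ : ∃ j, j ≠ i ∧ (y : V → ℝ) j ≠ 0 := by
    by_contra hn
    push Not at hn
    rw [eq_vertex_of_forall_ne y hn] at hy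
    have : ((δ / 2 : ℝ) : ℂ) = 0 := by linear_combination -hy
    have : δ / 2 = 0 := by exact_mod_cast this
    linarith
  refine ⟨j, hji.symm, mem_faces_of_pos y.2 (by simp) fun v hv => ?_⟩
  simp only [Finset.mem_insert, Finset.mem_singleton] at hv
  rcases hv with rfl | rfl
  · exact hyi
  · exact lt_of_le_of_ne (nonneg_apply y _) hj.symm

/-- An edge at a vertex whose image is interior to the image of `φ` has a triangle on each side. -/
lemma exists_triangle (hT : ∀ s ∈ T.faces, s.card ≤ 3) (hφ : IsGeodesicEmbedding T φ) (hε : 0 < ε)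
    (hnd : UniformlyNondegenerate T (inducedMetric T φ) ε)
    (hr : Set.range φ ∈ nhds (φ (vertex T i))) (he : IsEdge T i j) {c : ℝ} (hc : c ≠ 0) :
    ∃ k, IsTriangle T i j k ∧
      0 < c * cross (φ (vertex T j) - φ (vertex T i)) (φ (vertex T k) - φ (vertex T i)) := by
  set a := φ (vertex T j) - φ (vertex T i) with ha
  have hne : a ≠ 0 := hφ.sub_ne_zero_of_ne he.1
  obtain ⟨O, hO, hOe⟩ := hφ.isEmbedding.isOpen_iff.1
    ((isOpen_pos (T := T) i).inter (isOpen_pos (T := T) j))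
  obtain ⟨U, hU, hUo, hiU⟩ := mem_nhds_iff.1 hr
  obtain ⟨t, ht0, ht1, htU⟩ : ∃ t : ℝ, 0 < t ∧ t < 1 ∧ φ (vertex T i) + t * a ∈ U := by
    have hcont : Continuous fun t : ℝ => φ (vertex T i) + t * a := by fun_prop
    have h1 : ∀ᶠ t : ℝ in nhdsWithin 0 (Set.Ioi 0), φ (vertex T i) + t * a ∈ U :=
      nhdsWithin_le_nhds ((hUo.preimage hcont).mem_nhds (by simpa using hiU))
    have h2 : ∀ᶠ t : ℝ in nhdsWithin 0 (Set.Ioi 0), t ∈ Set.Ioo (0 : ℝ) 1 :=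
      Ioo_mem_nhdsGT zero_lt_one
    obtain ⟨t, h3, h4⟩ := (h1.and h2).exists
    exact ⟨t, h4.1, h4.2, h3⟩
  obtain ⟨x, hxe, hxi, hxj⟩ := hφ.exists_mem_edge he ht0 ht1
  have hxO : φ x ∈ O := by
    have : x ∈ φ ⁻¹' O := by rw [hOe]; exact ⟨hxi, hxj⟩
    exact this
  -- An inner point of the edge is pushed to the side chosen by the sign of c, since `cross a (c * I
  -- * a)` is c‖a‖². The preimage still has positive coordinates at i and j, but is off the edge, so
  -- it has a third vertex.
  obtain ⟨η, hη0, hηU⟩ : ∃ η : ℝ, 0 < η ∧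
      φ (vertex T i) + t * a + η * (c * Complex.I * a) ∈ U ∩ O := by
    have hcont : Continuous fun η : ℝ => φ (vertex T i) + t * a + η * (c * Complex.I * a) := by
      fun_prop
    have h1 : ∀ᶠ η : ℝ in nhdsWithin 0 (Set.Ioi 0),
        φ (vertex T i) + t * a + η * (c * Complex.I * a) ∈ U ∩ O :=
      nhdsWithin_le_nhds (((hUo.inter hO).preimage hcont).mem_nhds (by
        simp only [Set.mem_preimage, Complex.ofReal_zero, zero_mul, add_zero]
        exact ⟨htU, by rw [← hxe]; exact hxO⟩))
    obtain ⟨η, h3, h4⟩ := (h1.and self_mem_nhdsWithin).exists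
    exact ⟨η, h4, h3⟩
  obtain ⟨y, hy⟩ := hU hηU.1
  have hyO : y ∈ φ ⁻¹' O := by rw [Set.mem_preimage, hy]; exact hηU.2
  rw [hOe] at hyO
  obtain ⟨hyi, hyj⟩ := hyO
  simp only [Set.mem_ofPred_eq] at hyi hyj
  have hcy : cross a (φ y - φ (vertex T i)) = c * (η * ‖a‖ ^ 2) := by
    rw [hy, ← dot_self]
    simp [cross, dot]
    ring
  have hpos : 0 < η * ‖a‖ ^ 2 := by have := norm_pos_iff.2 hne; positivity
  obtain ⟨k, hki, hkj, hk⟩ : ∃ k, k ≠ i ∧ k ≠ j ∧ (y : V → ℝ) k ≠ 0 := by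
    by_contra hn
    push Not at hn
    obtain ⟨p, q, -, -, hpq, hs⟩ := hφ.mem_segment he (x := y) hn
    have h1 : φ y - φ (vertex T i) = q * a := by
      rw [← hs, Complex.real_smul, Complex.real_smul, ha]
      have : (p : ℂ) + q = 1 := by exact_mod_cast hpq
      linear_combination φ (vertex T i) * this
    have h2 : cross a (φ y - φ (vertex T i)) = 0 := by
      rw [h1]; simp [cross]; ring
    rw [hcy] at h2
    rcases mul_eq_zero.1 h2 with h3 | h3
    · exact hc h3
    · exact hpos.ne' h3
  have hkp : 0 < (y : V → ℝ) k := lt_of_le_of_ne (nonneg_apply y k) hk.symm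
  have htri : IsTriangle T i j k := ⟨he.1, hkj.symm, hki.symm,
    mem_faces_of_pos y.2 (by simp) fun v hv => by
      simp only [Finset.mem_insert, Finset.mem_singleton] at hv
      rcases hv with rfl | rfl | rfl <;> assumption⟩
  have hyz : ∀ v, v ≠ i → v ≠ j → v ≠ k → (y : V → ℝ) v = 0 := by
    intro v h1 h2 h3
    by_contra h4
    have h5 : ({v, i, j, k} : Finset V) ∈ T.faces :=
      mem_faces_of_pos y.2 (by simp) fun w hw => by
        simp only [Finset.mem_insert, Finset.mem_singleton] at hw
        rcases hw with rfl | rfl | rfl | rfl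
        · exact lt_of_le_of_ne (nonneg_apply y _) (Ne.symm h4)
        all_goals assumption
    have h6 := hT _ h5
    rw [Finset.card_insert_of_notMem (by simp [h1, h2, h3]),
      Finset.card_insert_of_notMem (by simp [he.1, hki.symm]),
      Finset.card_insert_of_notMem (by simpa using hkj.symm), Finset.card_singleton] at h6
    omega
  obtain ⟨s, t', hs, ht', -, hye⟩ := hφ.map_interior htri (hφ.cross_ne_zero hε hnd htri) hyz hyi
    hyj hkp
  refine ⟨k, htri, ?_⟩
  have h7 : cross a (φ y - φ (vertex T i)) = t' * cross a (φ (vertex T k) - φ (vertex T i)) := by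
    rw [hye]
    simp [cross, ha]
    ring
  rw [h7] at hcy
  have h8 : t' * (c * cross a (φ (vertex T k) - φ (vertex T i))) = c ^ 2 * (η * ‖a‖ ^ 2) := by
    linear_combination c * hcy
  have h9 : 0 < c ^ 2 * (η * ‖a‖ ^ 2) := by positivity
  rw [← h8] at h9
  exact (mul_pos_iff_of_pos_left ht').1 h9

end IsGeodesicEmbedding

end

/-! ### Stars of the triangulation and their conformal factors -/

lemma IsStar.smul {ι : Type*} {σ : Equiv.Perm ι} {ε : ℝ} {h : ι → ℂ} (hh : IsStar σ ε h) {c : ℝ}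
    (hc : 0 < c) : IsStar σ ε fun j => (c : ℂ) * h j := by
  have hc' : (c : ℂ) ≠ 0 := by exact_mod_cast hc.ne'
  have hcross : ∀ a b : ℂ, cross (c * a) (c * b) = c ^ 2 * cross a b := fun a b => by
    simp [cross]; ring
  have hdot : ∀ a b : ℂ, dot (c * a) (c * a - c * b) / (‖c * a‖ * ‖c * a - c * b‖)
      = dot a (a - b) / (‖a‖ * ‖a - b‖) := fun a b => by
    rw [← mul_sub, norm_mul, norm_mul, Complex.norm_real, Real.norm_eq_abs, abs_of_pos hc]
    have : dot (c * a) (c * (a - b)) = c * c * dot a (a - b) := by simp [dot]; ring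
    rw [this, show c * ‖a‖ * (c * ‖a - b‖) = c * c * (‖a‖ * ‖a - b‖) by ring,
      mul_div_mul_left _ _ (mul_pos hc hc).ne']
  refine ⟨fun j => mul_ne_zero hc' (hh.ne_zero j), fun j => ?_, fun j => ?_, fun j => ?_,
    fun j => ?_⟩
  · simpa only [mul_div_mul_left _ _ hc'] using hh.le_arg j
  · simpa only [mul_div_mul_left _ _ hc'] using hh.arg_le j
  · have h2 : 0 < c ^ 2 := by positivity
    simpa only [hcross, mul_pos_iff_of_pos_left h2] using hh.cross_pos_iff j
  · simpa only [hdot] using hh.delaunay j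

section

variable {V : Type*} [DecidableEq V] {T : AbstractSimplicialComplex V} {φ φ' : Space T → ℂ}
  {u : V → ℝ} {i j k : V} {ε : ℝ}

lemma finite_edges (hT : IsTriangulatedPlane T) (i : V) : Finite {j // IsEdge T i j} := by
  have : Finite {s ∈ T.faces | i ∈ s} := hT.locallyFinite i
  refine Finite.of_injective (β := {s ∈ T.faces | i ∈ s})
    (fun j => ⟨{i, j.1}, j.2.2, by simp⟩) fun j k hjk => ?_
  have h1 : ({i, j.1} : Finset V) = {i, k.1} := congrArg Subtype.val hjk
  have h2 : j.1 ∈ ({i, k.1} : Finset V) := by rw [← h1]; simp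
  simp only [Finset.mem_insert, Finset.mem_singleton] at h2
  exact Subtype.ext (h2.resolve_left j.2.1.symm)

/-- The triangles at a vertex whose image is interior to the image of `φ` are cyclically ordered. -/
lemma IsGeodesicEmbedding.exists_perm (hT : IsTriangulatedPlane T) (hφ : IsGeodesicEmbedding T φ)
    (hε : 0 < ε) (hnd : UniformlyNondegenerate T (inducedMetric T φ) ε)
    (hr : Set.range φ ∈ nhds (φ (vertex T i))) :
    ∃ σ : Equiv.Perm {j // IsEdge T i j}, ∀ j : {j // IsEdge T i j}, IsTriangle T i j (σ j) ∧
      0 < cross (φ (vertex T j) - φ (vertex T i)) (φ (vertex T (σ j)) - φ (vertex T i)) := by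
  have := finite_edges hT i
  have hex : ∀ j : {j // IsEdge T i j}, ∃ k : {j // IsEdge T i j}, IsTriangle T i j k ∧
      0 < cross (φ (vertex T j) - φ (vertex T i)) (φ (vertex T k) - φ (vertex T i)) := by
    intro j
    obtain ⟨k, hk, hc⟩ := hφ.exists_triangle hT.card_le hε hnd hr j.2 one_ne_zero
    exact ⟨⟨k, hk.swap.edge⟩, hk, by simpa using hc⟩
  choose f hf using hex
  -- Two neighbours with the same successor would span triangles on the same side of the edge to
  -- that successor.
  have hinj : Function.Injective f := by
    intro j k hjk
    have h1 := (hf j).1.swap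
    have h2 := (hf k).1.swap
    have c1 := (hf j).2
    have c2 := (hf k).2
    rw [← hjk] at h2 c2
    refine Subtype.ext (hφ.eq_of_same_side hε hnd h1 h2 ?_)
    refine (mul_pos c1 c2).trans_eq ?_
    simp only [cross]
    ring
  exact ⟨Equiv.ofBijective f (Finite.injective_iff_bijective.1 hinj), hf⟩

/-- The hypotheses on `σ` are combinatorial, so an order found from one embedding also serves
another, with either orientation and without assuming that its image surrounds the vertex. -/
lemma IsGeodesicEmbedding.isStar (hφ : IsGeodesicEmbedding T φ)
    (hε : 0 < ε) (hnd : UniformlyNondegenerate T (inducedMetric T φ) ε)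
    (hD : Delaunay T (inducedMetric T φ)) {σ : Equiv.Perm {j // IsEdge T i j}}
    (hσ : ∀ j : {j // IsEdge T i j}, IsTriangle T i j (σ j)) (hσ2 : ∀ j, σ (σ j) ≠ j) :
    IsStar σ ε fun j => φ (vertex T j) - φ (vertex T i) := by
  refine ⟨fun j => hφ.sub_ne_zero_of_ne j.2.1, fun j => ?_, fun j => ?_, fun j => ?_, fun j => ?_⟩
  · rw [← hφ.cornerAngle_eq_abs_arg (hσ j)]
    exact hnd _ _ _ (hσ j)
  · rw [← hφ.cornerAngle_eq_abs_arg (hσ j)]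
    exact hφ.cornerAngle_le hε hnd (hσ j)
  · have h1 := hφ.cross_ne_zero hε hnd (hσ j)
    have h2 := hφ.cross_ne_zero hε hnd (hσ (σ j))
    -- Consecutive triangles are distinct because `σ (σ j) ≠ j`, so they lie on opposite sides of
    -- their common edge; hence the orientation is constant along `σ`.
    have h3 : ¬ 0 < cross (φ (vertex T (σ j)) - φ (vertex T i)) (φ (vertex T j) - φ (vertex T i)) *
        cross (φ (vertex T (σ j)) - φ (vertex T i)) (φ (vertex T (σ (σ j))) - φ (vertex T i)) :=
      fun h => hσ2 j (Subtype.ext (hφ.eq_of_same_side hε hnd (hσ j).swap (hσ (σ j)) h)).symm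
    have h4 : cross (φ (vertex T (σ j)) - φ (vertex T i)) (φ (vertex T j) - φ (vertex T i))
        = -cross (φ (vertex T j) - φ (vertex T i)) (φ (vertex T (σ j)) - φ (vertex T i)) := by
      simp only [cross]; ring
    rw [h4] at h3
    constructor
    · intro h
      by_contra hn
      have := lt_of_le_of_ne (not_lt.1 hn) h2
      exact h3 (by nlinarith)
    · intro h
      by_contra hn
      have := lt_of_le_of_ne (not_lt.1 hn) h1
      exact h3 (by nlinarith)
  · have h1 := hD i (σ j) j (σ (σ j)) (hσ j).swap.rotate.rotate
      (hσ (σ j)).rotate.rotate fun h => hσ2 j (Subtype.ext h).symm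
    have key : ∀ k : V, cornerAngle (inducedMetric T φ) k i (σ j)
        = InnerProductGeometry.angle (φ (vertex T k) - φ (vertex T i))
          ((φ (vertex T k) - φ (vertex T i)) - (φ (vertex T (σ j)) - φ (vertex T i))) := by
      intro k
      rw [cornerAngle_eq_angle, ← InnerProductGeometry.angle_neg_neg, neg_sub, neg_sub,
        sub_sub_sub_cancel_right]
    rw [key, key] at h1
    rw [← cos_angle_eq, ← cos_angle_eq]
    exact cos_add_cos_nonneg (InnerProductGeometry.angle_nonneg _ _)
      (InnerProductGeometry.angle_nonneg _ _) h1

lemma DiscreteConformal.norm_eq (hu : DiscreteConformal T u (inducedMetric T φ)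
    (inducedMetric T φ')) (h : IsEdge T i j) : ‖φ' (vertex T j) - φ' (vertex T i)‖
      = Real.exp ((u i + u j) / 2) * ‖φ (vertex T j) - φ (vertex T i)‖ := by
  have := hu i j h
  rwa [inducedMetric, inducedMetric, dist_comm, dist_comm (φ _), dist_eq_norm, dist_eq_norm] at this

/-- The conformal factor at a vertex, compared to its neighbours. -/
lemma exists_edge_exp_le (hT : IsTriangulatedPlane T) (hφ : IsGeodesicEmbedding T φ)
    (hφ' : IsGeodesicEmbedding T φ') (hε : 0 < ε) (hε1 : ε ≤ 1)
    (hnd : UniformlyNondegenerate T (inducedMetric T φ) ε)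
    (hnd' : UniformlyNondegenerate T (inducedMetric T φ') ε)
    (hD : Delaunay T (inducedMetric T φ)) (hD' : Delaunay T (inducedMetric T φ'))
    (hu : DiscreteConformal T u (inducedMetric T φ) (inducedMetric T φ'))
    (hr : Set.range φ' ∈ nhds (φ' (vertex T i))) {d d' : ℂ}
    (hd : ∀ j, IsEdge T i j → ‖d * (φ (vertex T j) - φ (vertex T i))‖ ≤ ε / 4)
    (hd' : ∀ j, IsEdge T i j → ‖d' * (φ' (vertex T j) - φ' (vertex T i))‖ ≤ ε / 4) :
    ∃ j, IsEdge T i j ∧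
      Real.exp (u j - u i) * ‖1 - d * (φ (vertex T j) - φ (vertex T i))‖ ^ 2
        ≤ ‖1 - d' * (φ' (vertex T j) - φ' (vertex T i))‖ ^ 2 := by
  have := finite_edges hT i
  have := Fintype.ofFinite {j // IsEdge T i j}
  obtain ⟨σ, hσ⟩ := hφ'.exists_perm hT hε hnd' hr
  have hσ2 : ∀ j, σ (σ j) ≠ j := by
    intro j hj
    have h1 := (hσ j).2
    have h2 := (hσ (σ j)).2
    rw [hj] at h2
    simp only [cross] at h1 h2
    linarith
  have : Nonempty {j // IsEdge T i j} := by
    obtain ⟨j, hj⟩ := hφ'.exists_edge hr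
    exact ⟨⟨j, hj⟩⟩
  -- Scaling the star of φ by e^{u_i} compensates the factor that inversion leaves in the polygon
  -- sides.
  set c := Real.exp (u i) with hcdef
  have hc : 0 < c := Real.exp_pos _
  have hc' : (c : ℂ) ≠ 0 := by exact_mod_cast hc.ne'
  have hS := (hφ.isStar hε hnd hD (fun j => (hσ j).1) hσ2).smul hc
  have hS' := hφ'.isStar hε hnd' hD' (fun j => (hσ j).1) hσ2
  have harg : ∀ j : {j // IsEdge T i j}, 0 < ((φ' (vertex T (σ j)) - φ' (vertex T i)) /
      (φ' (vertex T j) - φ' (vertex T i))).arg := fun j => (hS'.arg_pos_iff hε j).2 (hσ j).2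
  have hsum : ∑ j, |((φ' (vertex T (σ j)) - φ' (vertex T i)) /
      (φ' (vertex T j) - φ' (vertex T i))).arg| ≤ 2 * Real.pi := by
    simp only [abs_of_pos (harg _)]
    refine sum_arg_le_two_pi (h := fun j : {j // IsEdge T i j} => φ' (vertex T j) - φ' (vertex T i))
      (k := fun j => φ' (vertex T (σ j)) - φ' (vertex T i)) hS'.ne_zero
      (fun j => hS'.ne_zero (σ j)) harg (fun j => ?_) ?_
    · have := (le_abs_self _).trans (hS'.arg_le j)
      linarith
    · intro j k hjk s t s' t' hs ht hs' ht' he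
      rcases hφ'.eq_or_eq_of_mem_sectors hε hnd' (hσ j).1 (hσ k).1 hs ht hs' ht' he with h | h
      · exact hjk (Subtype.ext h.1)
      · have h1 := (hσ j).2
        have h2 := (hσ k).2
        rw [h.1, h.2] at h1
        simp only [cross] at h1 h2
        linarith
  have hedge : ∀ j, ‖((c : ℂ) * (φ (vertex T (σ j)) - φ (vertex T i)))⁻¹
      - (c * (φ (vertex T j) - φ (vertex T i)))⁻¹‖
      = ‖(φ' (vertex T (σ j)) - φ' (vertex T i))⁻¹ - (φ' (vertex T j) - φ' (vertex T i))⁻¹‖ := by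
    intro j
    have inv : ∀ a b : ℂ, a ≠ 0 → b ≠ 0 → ‖a⁻¹ - b⁻¹‖ = ‖b - a‖ / (‖a‖ * ‖b‖) := by
      intro a b ha hb
      rw [inv_sub_inv ha hb, norm_div, norm_mul]
    rw [inv _ _ (hS.ne_zero _) (hS.ne_zero _), inv _ _ (hS'.ne_zero _) (hS'.ne_zero _), ← mul_sub,
      sub_sub_sub_cancel_right, sub_sub_sub_cancel_right, norm_mul, norm_mul, norm_mul,
      hu.norm_eq j.2, hu.norm_eq (σ j).2, hu.norm_eq (hσ j).1.rotate.edge.symm, Complex.norm_real,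
      Real.norm_eq_abs, abs_of_pos hc]
    have n1 := norm_ne_zero_iff.2 (hφ.sub_ne_zero_of_ne j.2.1)
    have n2 := norm_ne_zero_iff.2 (hφ.sub_ne_zero_of_ne (σ j).2.1)
    have e1 : Real.exp ((u i + u (σ j)) / 2) * Real.exp ((u i + u j) / 2)
        = c * Real.exp ((u (σ j) + u j) / 2) := by
      rw [hcdef, ← Real.exp_add, ← Real.exp_add]; congr 1; ring
    have p1 := Real.exp_ne_zero ((u i + u (σ j)) / 2)
    have p2 := Real.exp_ne_zero ((u i + u j) / 2)
    rw [div_eq_div_iff (by positivity) (by positivity)]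
    linear_combination (c * ‖φ (vertex T j) - φ (vertex T (σ j))‖ *
      ‖φ (vertex T j) - φ (vertex T i)‖ * ‖φ (vertex T (σ j)) - φ (vertex T i)‖) * e1
  -- Scaling the star by c scales its inversion by 1/c, hence the base point `d / c`.
  obtain ⟨j, hj⟩ := hS.exists_norm_le hS' hε hε1 hsum hedge (d := d / c) (d' := d')
    (fun j => by
      rw [div_mul_eq_mul_div, mul_left_comm, mul_div_cancel_left₀ _ hc']
      exact hd j j.2) (fun j => hd' j j.2)
  refine ⟨j, j.2, ?_⟩
  set a := φ (vertex T j) - φ (vertex T i)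
  have hne : a ≠ 0 := hφ.sub_ne_zero_of_ne j.2.1
  have hne' := hφ'.sub_ne_zero_of_ne j.2.1
  have e1 : ((c : ℂ) * a)⁻¹ - d / c = (1 - d * a) / (c * a) := by field_simp
  have e2 : (φ' (vertex T j) - φ' (vertex T i))⁻¹ - d'
      = (1 - d' * (φ' (vertex T j) - φ' (vertex T i))) / (φ' (vertex T j) - φ' (vertex T i)) := by
    field_simp
  rw [e1, e2, norm_div, norm_div, norm_mul, Complex.norm_real, Real.norm_eq_abs, abs_of_pos hc,
    hu.norm_eq j.2, div_le_div_iff₀ (mul_pos hc (norm_pos_iff.2 hne))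
      (mul_pos (Real.exp_pos _) (norm_pos_iff.2 hne)), ← mul_assoc, ← mul_assoc,
    mul_le_mul_iff_left₀ (norm_pos_iff.2 hne)] at hj
  have e3 : Real.exp ((u i + u j) / 2) = Real.exp ((u j - u i) / 2) * c := by
    rw [hcdef, ← Real.exp_add]; congr 1; ring
  rw [e3, ← mul_assoc, mul_le_mul_iff_left₀ hc] at hj
  have e4 : Real.exp (u j - u i) = Real.exp ((u j - u i) / 2) ^ 2 := by
    rw [← Real.exp_nat_mul]; congr 1; push_cast; ring
  rw [e4, ← mul_pow, mul_comm]
  exact pow_le_pow_left₀ (by positivity) hj 2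

/-- The conformal factor at a vertex is controlled by the scaling of an adjacent edge. -/
lemma sin_sq_mul_le_exp (hφ : IsGeodesicEmbedding T φ) (hφ' : IsGeodesicEmbedding T φ')
    (hε : 0 < ε) (hε1 : ε ≤ 1) (hnd : UniformlyNondegenerate T (inducedMetric T φ) ε)
    (hnd' : UniformlyNondegenerate T (inducedMetric T φ') ε)
    (hu : DiscreteConformal T u (inducedMetric T φ) (inducedMetric T φ'))
    (h : IsTriangle T i j k) :
    Real.sin ε ^ 2 * inducedMetric T φ' i j ≤ Real.exp (u i) * inducedMetric T φ i j := by
  have hs : 0 < Real.sin ε := Real.sin_pos_of_pos_of_lt_pi hε (by linarith [Real.pi_gt_three])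
  have pos : ∀ {ψ : Space T → ℂ} {a b : V}, IsGeodesicEmbedding T ψ → a ≠ b →
      0 < inducedMetric T ψ a b := by
    intro ψ a b hψ hab
    exact dist_pos.2 fun h0 => hab (vertex_injective (hψ.isEmbedding.injective h0))
  have symm : ∀ (ψ : Space T → ℂ) (a b : V), inducedMetric T ψ a b = inducedMetric T ψ b a :=
    fun ψ a b => dist_comm _ _
  have h1 := hφ.sin_mul_le hε hnd h.swap
  have h2 := hφ'.sin_mul_le hε hnd' h.rotate
  have e1 := hu i j h.edge
  have e2 := hu i k h.swap.edge
  have e3 := hu j k h.rotate.edge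
  rw [symm φ k j] at h1
  rw [symm φ' k i] at h2
  have hb := pos hφ h.2.2.1
  have hd' := pos hφ' h.2.1
  have ha' := pos hφ' h.1
  have h3 : (Real.sin ε * inducedMetric T φ' j k) * (Real.sin ε * inducedMetric T φ i k)
      ≤ inducedMetric T φ' i k * inducedMetric T φ j k :=
    mul_le_mul h2 h1 (mul_nonneg hs.le hb.le) (pos hφ' h.2.2.1).le
  have e4 : Real.exp ((u i + u j) / 2) * Real.exp ((u i + u k) / 2)
      = Real.exp (u i) * Real.exp ((u j + u k) / 2) := by
    rw [← Real.exp_add, ← Real.exp_add]; congr 1; ring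
  -- In l'_ij l'_ik / l'_jk the factors at j and k cancel and e^{u_i} remains. The other two ratios
  -- are bounded by the law of sines, once in each metric.
  have e5 : inducedMetric T φ' i j * (inducedMetric T φ' i k * inducedMetric T φ j k)
      = Real.exp (u i) * inducedMetric T φ i j *
        (inducedMetric T φ' j k * inducedMetric T φ i k) := by
    rw [e1, e2, e3]
    linear_combination (inducedMetric T φ i j * inducedMetric T φ i k * inducedMetric T φ j k) * e4
  refine le_of_mul_le_mul_right ?_ (mul_pos hd' hb)
  calc _ = inducedMetric T φ' i j * ((Real.sin ε * inducedMetric T φ' j k) *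
        (Real.sin ε * inducedMetric T φ i k)) := by ring
    _ ≤ _ := mul_le_mul_of_nonneg_left h3 ha'.le
    _ = _ := e5

end

/-! ### Vertices in a disk and the covering subcomplex -/

section

variable {V : Type*} [DecidableEq V] {T : AbstractSimplicialComplex V} {φ φ' : Space T → ℂ}
  {u : V → ℝ} {i j : V} {ε : ℝ}

/-- Only finitely many vertices are mapped into a disk whose closure lies in the image. -/
lemma IsGeodesicEmbedding.finite_vertices (hφ : IsGeodesicEmbedding T φ) {r ρ : ℝ} (hρ : ρ < r)
    (hr : Metric.ball 0 r ⊆ Set.range φ) : {i | φ (vertex T i) ∈ Metric.ball 0 ρ}.Finite := by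
  -- The preimage of the closed disk is compact because the disk lies in the range. Finitely many
  -- open stars cover it, and a vertex lies in no open star but its own.
  have hK : IsCompact (φ ⁻¹' Metric.closedBall 0 ρ) :=
    (hφ.isEmbedding.isInducing.isCompact_preimage_iff
      ((Metric.closedBall_subset_ball hρ).trans hr)).2 (isCompact_closedBall 0 ρ)
  obtain ⟨t, ht⟩ := hK.elim_finite_subcover (fun v : V => {y : Space T | 0 < (y : V → ℝ) v})
    (fun v => isOpen_pos v) fun y _ => by
      obtain ⟨s, hs, h0, h1, h2⟩ := y.2
      by_contra hn
      simp only [Set.mem_iUnion, Set.mem_ofPred_eq, not_exists, not_lt] at hn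
      have : ∑ v ∈ s, (y : V → ℝ) v ≤ 0 := Finset.sum_nonpos fun v _ => hn v
      linarith
  refine t.finite_toSet.subset fun i hi => ?_
  have hi' := ht (Metric.ball_subset_closedBall hi : vertex T i ∈ φ ⁻¹' Metric.closedBall 0 ρ)
  simp only [Set.mem_iUnion, Set.mem_ofPred_eq, vertex_apply] at hi'
  obtain ⟨v, hv, hvi⟩ := hi'
  split_ifs at hvi with h
  · rwa [← h]
  · exact absurd hvi (lt_irrefl 0)

lemma vertex_mem_carrier_iff {K : PreAbstractSimplicialComplex V} :
    vertex T i ∈ carrier T K ↔ {i} ∈ K.faces := by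
  constructor
  · intro h
    refine mem_faces_of_pos h (by simp) fun v hv => ?_
    rw [Finset.mem_singleton.1 hv, vertex_apply, if_pos rfl]
    exact one_pos
  · intro h
    refine ⟨{i}, h, nonneg_apply _, fun v hv => ?_, ?_⟩
    · rw [vertex_apply, if_neg (by simpa using hv)]
    · rw [Finset.sum_singleton, vertex_apply, if_pos rfl]

/-- A subcomplex that covers a disk contains the neighbours of the vertices in this disk. -/
lemma IsGeodesicEmbedding.singleton_mem_of_edge (hφ : IsGeodesicEmbedding T φ)
    {K : PreAbstractSimplicialComplex V} {r : ℝ}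
    (hK : Metric.ball 0 r ⊆ φ '' carrier T K) (hi : φ (vertex T i) ∈ Metric.ball 0 r)
    (he : IsEdge T i j) : {j} ∈ K.faces := by
  -- Points of the open edge close to φ(i) are covered by K, and their coordinate at j is positive.
  have hcont : Continuous fun t : ℝ => φ (vertex T i) + t * (φ (vertex T j) - φ (vertex T i)) := by
    fun_prop
  have h1 : ∀ᶠ t : ℝ in nhdsWithin 0 (Set.Ioi 0),
      φ (vertex T i) + t * (φ (vertex T j) - φ (vertex T i)) ∈ Metric.ball 0 r :=
    nhdsWithin_le_nhds ((Metric.isOpen_ball.preimage hcont).mem_nhds (by simpa using hi))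
  have h2 : ∀ᶠ t : ℝ in nhdsWithin 0 (Set.Ioi 0), t ∈ Set.Ioo (0 : ℝ) 1 :=
    Ioo_mem_nhdsGT zero_lt_one
  obtain ⟨t, h3, h4⟩ := (h1.and h2).exists
  obtain ⟨x, hx, -, hxj⟩ := hφ.exists_mem_edge he h4.1 h4.2
  rw [← hx] at h3
  obtain ⟨y, hy, hyx⟩ := hK h3
  rw [hφ.isEmbedding.injective hyx] at hy
  exact mem_faces_of_pos hy (by simp) fun v hv => by rwa [Finset.mem_singleton.1 hv]

end

/-! ### The hyperbolic conformal factor and its minimum principle -/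

/-- The Möbius identity `|R² - conj a * z|² = R² |z - a|² + (R² - |a|²) (R² - |z|²)`, normalized. -/
lemma norm_one_sub_sq {R : ℝ} {a z : ℂ} (ha : ‖a‖ < R) :
    ‖1 - (starRingEnd ℂ) a / ((R ^ 2 - ‖a‖ ^ 2 : ℝ) : ℂ) * (z - a)‖ ^ 2
      = (R ^ 2 - ‖z‖ ^ 2) / (R ^ 2 - ‖a‖ ^ 2)
        + R ^ 2 * ‖z - a‖ ^ 2 / (R ^ 2 - ‖a‖ ^ 2) ^ 2 := by
  have hN : 0 < R ^ 2 - ‖a‖ ^ 2 := by nlinarith [norm_nonneg a]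
  have hN' : ((R ^ 2 - ‖a‖ ^ 2 : ℝ) : ℂ) ≠ 0 := by exact_mod_cast hN.ne'
  have e : 1 - (starRingEnd ℂ) a / ((R ^ 2 - ‖a‖ ^ 2 : ℝ) : ℂ) * (z - a)
      = (R ^ 2 - (starRingEnd ℂ) a * z) / ((R ^ 2 - ‖a‖ ^ 2 : ℝ) : ℂ) := by
    have h1 : (starRingEnd ℂ) a * a = ((‖a‖ ^ 2 : ℝ) : ℂ) := by
      rw [mul_comm, Complex.mul_conj, Complex.normSq_eq_norm_sq]
    rw [eq_div_iff hN', sub_mul, mul_right_comm, div_mul_cancel₀ _ hN']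
    push_cast at h1 ⊢
    linear_combination h1
  rw [e, norm_div, Complex.norm_real, Real.norm_eq_abs, abs_of_pos hN, div_pow]
  have h2 : ‖(R : ℂ) ^ 2 - (starRingEnd ℂ) a * z‖ ^ 2
      = R ^ 2 * ‖z - a‖ ^ 2 + (R ^ 2 - ‖a‖ ^ 2) * (R ^ 2 - ‖z‖ ^ 2) := by
    rw [← dot_self, ← dot_self, ← dot_self, ← dot_self]
    have hre : ((R : ℂ) ^ 2).re = R ^ 2 := by rw [← Complex.ofReal_pow, Complex.ofReal_re]
    have him : ((R : ℂ) ^ 2).im = 0 := by rw [← Complex.ofReal_pow, Complex.ofReal_im]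
    simp only [dot, Complex.sub_re, Complex.sub_im, Complex.mul_re, Complex.mul_im,
      Complex.conj_re, Complex.conj_im, hre, him]
    ring
  rw [h2]
  field_simp
  ring

lemma norm_conj_div_mul_le {R δ : ℝ} {a h : ℂ} (ha : ‖a‖ < R)
    (hh : ‖a‖ * ‖h‖ ≤ δ * (R ^ 2 - ‖a‖ ^ 2)) :
    ‖(starRingEnd ℂ) a / ((R ^ 2 - ‖a‖ ^ 2 : ℝ) : ℂ) * h‖ ≤ δ := by
  have hN : 0 < R ^ 2 - ‖a‖ ^ 2 := by nlinarith [norm_nonneg a]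
  rw [norm_mul, norm_div, Complex.norm_conj, Complex.norm_real, Real.norm_eq_abs, abs_of_pos hN,
    div_mul_eq_mul_div, div_le_iff₀ hN]
  exact hh

section

variable {V : Type*} [DecidableEq V] {T : AbstractSimplicialComplex V} {φ φ' : Space T → ℂ}
  {u : V → ℝ} {i j : V} {ε : ℝ}

/-- The discrete hyperbolic conformal factor (exponentiated) of `φ'` in the disk of radius `ρ`
relative to `φ` in the disk of radius `R`. -/
noncomputable def hypFactor (φ φ' : Space T → ℂ) (u : V → ℝ) (R ρ : ℝ) (i : V) : ℝ :=
  Real.exp (u i) * (R ^ 2 - ‖φ (vertex T i)‖ ^ 2) / (ρ ^ 2 - ‖φ' (vertex T i)‖ ^ 2)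

/-- The discrete hyperbolic conformal factor has no interior minimum below `R / ρ`. -/
lemma le_hypFactor_of_forall_le (hT : IsTriangulatedPlane T) (hφ : IsGeodesicEmbedding T φ)
    (hφ' : IsGeodesicEmbedding T φ') (hε : 0 < ε) (hε1 : ε ≤ 1)
    (hnd : UniformlyNondegenerate T (inducedMetric T φ) ε)
    (hnd' : UniformlyNondegenerate T (inducedMetric T φ') ε)
    (hD : Delaunay T (inducedMetric T φ)) (hD' : Delaunay T (inducedMetric T φ'))
    (hu : DiscreteConformal T u (inducedMetric T φ) (inducedMetric T φ'))
    (hr : Set.range φ' ∈ nhds (φ' (vertex T i))) {R ρ : ℝ} (hρ : 0 < ρ)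
    (hi : ‖φ (vertex T i)‖ < R) (hi' : ‖φ' (vertex T i)‖ < ρ)
    (hd : ∀ j, IsEdge T i j → ‖φ (vertex T i)‖ * ‖φ (vertex T j) - φ (vertex T i)‖
      ≤ ε / 4 * (R ^ 2 - ‖φ (vertex T i)‖ ^ 2))
    (hd' : ∀ j, IsEdge T i j → ‖φ' (vertex T i)‖ * ‖φ' (vertex T j) - φ' (vertex T i)‖
      ≤ ε / 4 * (ρ ^ 2 - ‖φ' (vertex T i)‖ ^ 2))
    (hj' : ∀ j, IsEdge T i j → ‖φ' (vertex T j)‖ < ρ)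
    (hmin : ∀ j, IsEdge T i j → hypFactor φ φ' u R ρ i ≤ hypFactor φ φ' u R ρ j) :
    R / ρ ≤ hypFactor φ φ' u R ρ i := by
  by_contra hlt
  push Not at hlt
  -- The base point is d = conj a / (R² - |a|²), which for a ≠ 0 is 1/(a* - a) with a* = R²/conj a
  -- the mirror image of a in the circle |z| = R; likewise for d' and ρ.
  obtain ⟨j, he, hj⟩ := exists_edge_exp_le hT hφ hφ' hε hε1 hnd hnd' hD hD' hu hr
    (fun j he => norm_conj_div_mul_le hi (hd j he))
    (fun j he => norm_conj_div_mul_le hi' (hd' j he))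
  rw [norm_one_sub_sq hi, norm_one_sub_sq hi', hu.norm_eq he] at hj
  have hm := hmin j he
  have hh : 0 < ‖φ (vertex T j) - φ (vertex T i)‖ := norm_pos_iff.2 (hφ.sub_ne_zero_of_ne he.1)
  simp only [hypFactor] at hm hlt
  have hN : 0 < R ^ 2 - ‖φ (vertex T i)‖ ^ 2 := by nlinarith [norm_nonneg (φ (vertex T i))]
  have hN' : 0 < ρ ^ 2 - ‖φ' (vertex T i)‖ ^ 2 := by nlinarith [norm_nonneg (φ' (vertex T i))]
  have hM' : 0 < ρ ^ 2 - ‖φ' (vertex T j)‖ ^ 2 := by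
    nlinarith [norm_nonneg (φ' (vertex T j)), hj' j he]
  have hR : 0 < R := (norm_nonneg _).trans_lt hi
  generalize R ^ 2 - ‖φ (vertex T i)‖ ^ 2 = N at *
  generalize ρ ^ 2 - ‖φ' (vertex T i)‖ ^ 2 = N' at *
  generalize R ^ 2 - ‖φ (vertex T j)‖ ^ 2 = M at *
  generalize ρ ^ 2 - ‖φ' (vertex T j)‖ ^ 2 = M' at *
  generalize ‖φ (vertex T j) - φ (vertex T i)‖ = l at *
  have hE : 0 < Real.exp (u j - u i) := Real.exp_pos _
  have ej : Real.exp (u j) = Real.exp (u j - u i) * Real.exp (u i) := by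
    rw [← Real.exp_add]; congr 1; ring
  have el : (Real.exp ((u i + u j) / 2) * l) ^ 2
      = Real.exp (u j - u i) * (Real.exp (u i) * l) ^ 2 := by
    rw [mul_pow, mul_pow, ← mul_assoc, ← Real.exp_nat_mul, ← Real.exp_nat_mul, ← Real.exp_add]
    congr 2; push_cast; ring
  rw [el] at hj
  rw [ej] at hm
  generalize Real.exp (u j - u i) = E at *
  have hc : 0 < Real.exp (u i) := Real.exp_pos _
  generalize Real.exp (u i) = c at *
  -- Minimality at i compares the first terms of the two Möbius expansions; the negated conclusion
  -- compares the second terms strictly. Their sum contradicts `hj`.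
  have h1 : M' / N' ≤ E * (M / N) := by
    rw [div_le_div_iff₀ hN' hM'] at hm
    rw [← mul_div_assoc, div_le_div_iff₀ hN' hN]
    refine le_of_mul_le_mul_left ?_ hc
    linarith
  have h2 : ρ * c / N' < R / N := by
    rw [div_lt_div_iff₀ hN' hρ] at hlt
    rw [div_lt_div_iff₀ hN' hN]
    linarith
  have h3 : ρ ^ 2 * (E * (c * l) ^ 2) / N' ^ 2 < E * (R ^ 2 * l ^ 2 / N ^ 2) := by
    have h4 : (ρ * c / N') ^ 2 < (R / N) ^ 2 := pow_lt_pow_left₀ h2 (by positivity) two_ne_zero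
    have h5 : 0 < E * l ^ 2 := by positivity
    calc _ = E * l ^ 2 * (ρ * c / N') ^ 2 := by ring
      _ < E * l ^ 2 * (R / N) ^ 2 := mul_lt_mul_of_pos_left h4 h5
      _ = _ := by ring
  rw [mul_add] at hj
  linarith

/-- The lower bound for the discrete hyperbolic conformal factor. -/
lemma le_hypFactor (hT : IsTriangulatedPlane T) (hφ : IsGeodesicEmbedding T φ)
    (hφ' : IsGeodesicEmbedding T φ') (hε : 0 < ε) (hε1 : ε ≤ 1)
    (hnd : UniformlyNondegenerate T (inducedMetric T φ) ε)
    (hnd' : UniformlyNondegenerate T (inducedMetric T φ') ε)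
    (hD : Delaunay T (inducedMetric T φ)) (hD' : Delaunay T (inducedMetric T φ'))
    (hu : DiscreteConformal T u (inducedMetric T φ) (inducedMetric T φ'))
    {T₀ : PreAbstractSimplicialComplex V} {r r' ρ K : ℝ} (hr : 0 < r)
    (hφr : φ '' carrier T T₀ ⊆ Metric.ball 0 r) (hφr' : Metric.ball 0 r' ⊆ φ' '' carrier T T₀)
    (hρ : 0 < ρ) (hρr : ρ < r') (hK : 0 < K) (hKε : 8 / ε ≤ K ^ 2 - 1)
    (hi' : φ' (vertex T i) ∈ Metric.ball 0 ρ) :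
    min K (ε / 4 * Real.sin ε ^ 2 * (K ^ 2 - 1) / 4) * (r / ρ)
      ≤ hypFactor φ φ' u (K * r) ρ i := by
  have hK1 : 0 < K ^ 2 - 1 := lt_of_lt_of_le (by positivity) hKε
  have hrR : r < K * r := by nlinarith
  have hrange : Metric.ball 0 r' ⊆ Set.range φ' := hφr'.trans (Set.image_subset_range _ _)
  obtain ⟨k, hk, hkmin⟩ := (hφ'.finite_vertices hρr hrange).exists_minimalFor
    (hypFactor φ φ' u (K * r) ρ) _ ⟨i, hi'⟩
  have hkmin' : ∀ j, φ' (vertex T j) ∈ Metric.ball 0 ρ →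
      hypFactor φ φ' u (K * r) ρ k ≤ hypFactor φ φ' u (K * r) ρ j := by
    intro j hj
    rcases le_total (hypFactor φ φ' u (K * r) ρ k) (hypFactor φ φ' u (K * r) ρ j) with h | h
    · exact h
    · exact hkmin hj h
  refine le_trans ?_ (hkmin' i hi')
  have hkr' : φ' (vertex T k) ∈ Metric.ball 0 r' := Metric.ball_subset_ball hρr.le hk
  have hnhds : Set.range φ' ∈ nhds (φ' (vertex T k)) :=
    Filter.mem_of_superset (Metric.isOpen_ball.mem_nhds hkr') hrange
  have hball : ∀ {j}, {j} ∈ T₀.faces → ‖φ (vertex T j)‖ < r := fun hj => by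
    have := hφr ⟨_, vertex_mem_carrier_iff.2 hj, rfl⟩
    rwa [mem_ball_zero_iff] at this
  have hnbr : ∀ j, IsEdge T k j → ‖φ (vertex T j)‖ < r := fun j he =>
    hball (hφ'.singleton_mem_of_edge hφr' hkr' he)
  have hkr : ‖φ (vertex T k)‖ < r := by
    obtain ⟨y, hy, hyk⟩ := hφr' hkr'
    rw [hφ'.isEmbedding.injective hyk] at hy
    exact hball (vertex_mem_carrier_iff.1 hy)
  simp only [Set.mem_ofPred_eq, mem_ball_zero_iff] at hk
  have hl : ∀ j, IsEdge T k j → ‖φ (vertex T j) - φ (vertex T k)‖ ≤ 2 * r := fun j he => by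
    have := norm_sub_le (φ (vertex T j)) (φ (vertex T k))
    have := hnbr j he
    linarith
  have hzk := norm_nonneg (φ (vertex T k))
  have hzk' := norm_nonneg (φ' (vertex T k))
  have hNr : (K ^ 2 - 1) * r ^ 2 ≤ (K * r) ^ 2 - ‖φ (vertex T k)‖ ^ 2 := by nlinarith
  have hN' : 0 < ρ ^ 2 - ‖φ' (vertex T k)‖ ^ 2 := by nlinarith
  have hrρ : 0 < r / ρ := by positivity
  -- Either some edge at k is long relative to the distance from φ'(k) to the circle of radius ρ, or
  -- the star is small enough for the minimum principle.
  by_cases hcase : ∃ j, IsEdge T k j ∧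
      ε / 4 * (ρ - ‖φ' (vertex T k)‖) ≤ ‖φ' (vertex T j) - φ' (vertex T k)‖
  · obtain ⟨j, he, hj⟩ := hcase
    obtain ⟨m, hm, -⟩ := hφ'.exists_triangle hT.card_le hε hnd' hnhds he one_ne_zero
    have h1 := sin_sq_mul_le_exp hφ hφ' hε hε1 hnd hnd' hu hm
    simp only [inducedMetric, dist_eq_norm] at h1
    rw [norm_sub_rev, norm_sub_rev (φ (vertex T k))] at h1
    have hs : 0 ≤ Real.sin ε ^ 2 := sq_nonneg _
    have h2 : Real.sin ε ^ 2 * (ε / 4 * (ρ - ‖φ' (vertex T k)‖)) ≤ Real.exp (u k) * (2 * r) :=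
      (mul_le_mul_of_nonneg_left hj hs).trans
        (h1.trans (mul_le_mul_of_nonneg_left (hl j he) (Real.exp_pos _).le))
    refine (mul_le_mul_of_nonneg_right (min_le_right _ _) hrρ.le).trans ?_
    rw [hypFactor, le_div_iff₀ hN']
    have h3 : Real.exp (u k) * ((K ^ 2 - 1) * r ^ 2)
        ≤ Real.exp (u k) * ((K * r) ^ 2 - ‖φ (vertex T k)‖ ^ 2) :=
      mul_le_mul_of_nonneg_left hNr (Real.exp_pos _).le
    refine le_trans ?_ h3
    -- The factor ρ - |φ'(k)| appears both here and in the length of the long edge, so it drops out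
    -- of the estimate.
    have h4 : ρ ^ 2 - ‖φ' (vertex T k)‖ ^ 2 ≤ (ρ - ‖φ' (vertex T k)‖) * (2 * ρ) := by nlinarith
    have h5 : 0 ≤ ε / 4 * Real.sin ε ^ 2 * (K ^ 2 - 1) / 4 * (r / ρ) := by positivity
    calc ε / 4 * Real.sin ε ^ 2 * (K ^ 2 - 1) / 4 * (r / ρ) * (ρ ^ 2 - ‖φ' (vertex T k)‖ ^ 2)
        ≤ ε / 4 * Real.sin ε ^ 2 * (K ^ 2 - 1) / 4 * (r / ρ)
          * ((ρ - ‖φ' (vertex T k)‖) * (2 * ρ)) := mul_le_mul_of_nonneg_left h4 h5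
      _ = (Real.sin ε ^ 2 * (ε / 4 * (ρ - ‖φ' (vertex T k)‖))) * ((K ^ 2 - 1) * r / 2) := by
        field_simp
        ring
      _ ≤ (Real.exp (u k) * (2 * r)) * ((K ^ 2 - 1) * r / 2) :=
        mul_le_mul_of_nonneg_right h2 (by positivity)
      _ = _ := by ring
  · push Not at hcase
    refine (mul_le_mul_of_nonneg_right (min_le_left _ _) hrρ.le).trans ?_
    rw [← mul_div_assoc]
    have hlt : ∀ j, IsEdge T k j → ‖φ' (vertex T j)‖ < ρ := fun j he => by
      have h1 := hcase j he
      have h2 := norm_sub_norm_le (φ' (vertex T j)) (φ' (vertex T k))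
      nlinarith
    refine le_hypFactor_of_forall_le hT hφ hφ' hε hε1 hnd hnd' hD hD' hu hnhds hρ
      (hkr.trans hrR) hk (fun j he => ?_) (fun j he => ?_) hlt
      fun j he => hkmin' j (by simpa using hlt j he)
    -- Enlarging D_r to D_{Kr} makes every star of φ small enough: its spokes are at most 2r, while
    -- R² - |φ(k)|² is at least (K² - 1) r².
    · have h1 : 8 ≤ (K ^ 2 - 1) * ε := (div_le_iff₀ hε).1 hKε
      calc _ ≤ r * (2 * r) := mul_le_mul hkr.le (hl j he) (norm_nonneg _) hr.le
        _ = 8 / 4 * r ^ 2 := by ring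
        _ ≤ (K ^ 2 - 1) * ε / 4 * r ^ 2 := by gcongr
        _ = ε / 4 * ((K ^ 2 - 1) * r ^ 2) := by ring
        _ ≤ _ := mul_le_mul_of_nonneg_left hNr (by positivity)
    · calc _ ≤ ρ * (ε / 4 * (ρ - ‖φ' (vertex T k)‖)) :=
            mul_le_mul hk.le (hcase j he).le (norm_nonneg _) hρ.le
        _ = ε / 4 * (ρ * (ρ - ‖φ' (vertex T k)‖)) := by ring
        _ ≤ _ := mul_le_mul_of_nonneg_left (by nlinarith) (by positivity)

end

end TriPlane

/-! ### The explicit constant -/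

theorem mainTheorem2 (ε : ℝ) (hε : 0 < ε) :
    ∃ M : ℝ, 0 < M ∧
      ∀ (V : Type*) [DecidableEq V] (T : AbstractSimplicialComplex V)
        (φ φ' : TriPlane.Space T → ℂ) (u : V → ℝ) (r r' : ℝ)
        (T₀ : PreAbstractSimplicialComplex V),
        TriPlane.IsTriangulatedPlane T →
        TriPlane.IsGeodesicEmbedding T φ →
        TriPlane.IsGeodesicEmbedding T φ' →
        TriPlane.UniformlyNondegenerate T (TriPlane.inducedMetric T φ) ε →
        TriPlane.UniformlyNondegenerate T (TriPlane.inducedMetric T φ') ε →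
        TriPlane.Delaunay T (TriPlane.inducedMetric T φ) →
        TriPlane.Delaunay T (TriPlane.inducedMetric T φ') →
        TriPlane.DiscreteConformal T u (TriPlane.inducedMetric T φ)
          (TriPlane.inducedMetric T φ') →
        0 < r → 0 < r' →
        T₀ ≤ T.toPreAbstractSimplicialComplex →
        φ '' TriPlane.carrier T T₀ ⊆ Metric.ball 0 r →
        Metric.ball 0 r' ⊆ φ' '' TriPlane.carrier T T₀ →
        ∀ i : V, {i} ∈ T₀.faces → φ' (TriPlane.vertex T i) ∈ Metric.ball (0 : ℂ) (r' / 2) →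
          Real.log (r' / r) - M ≤ u i := by
  -- Lowering the angle bound to at most 1 is harmless and is required by the logarithm estimate for
  -- stars.
  set δ := min ε 1 with hδdef
  have hδ : 0 < δ := lt_min hε one_pos
  have hδ1 : δ ≤ 1 := min_le_right _ _
  have hsin : 0 < Real.sin δ :=
    Real.sin_pos_of_pos_of_lt_pi hδ (by linarith [Real.pi_gt_three])
  let K : ℝ := 1 + 8 / δ
  have hK : 0 < K := by positivity
  have hKδ : 8 / δ ≤ K ^ 2 - 1 := by
    have : 0 < 8 / δ := by positivity
    simp only [K]
    nlinarith
  have hK1 : 0 < K ^ 2 - 1 := lt_of_lt_of_le (by positivity) hKδ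
  let m : ℝ := min K (δ / 4 * Real.sin δ ^ 2 * (K ^ 2 - 1) / 4)
  have hm : 0 < m := lt_min hK (by positivity)
  -- The number 5m/(12K²) is (4/3)(5/16) m / K²: the first factor is r'/ρ, the second comes from
  -- (3/4)² - (1/2)².
  refine ⟨max 1 (-Real.log (5 * m / (12 * K ^ 2))), lt_max_of_lt_left one_pos, ?_⟩
  intro V _ T φ φ' u r r' T₀ hT hφ hφ' hnd hnd' hD hD' hu hr hr' _ hφr hφr' i hi hi'
  -- The radius 3r'/4 is below r', so that only finitely many vertices are involved, and above r'/2,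
  -- so that the denominator at i is at least 5r'²/16.
  have hW := TriPlane.le_hypFactor hT hφ hφ' hδ hδ1
    (fun a b c h => (min_le_left _ _).trans (hnd a b c h))
    (fun a b c h => (min_le_left _ _).trans (hnd' a b c h)) hD hD' hu hr hφr hφr'
    (ρ := 3 / 4 * r') (by positivity) (by linarith) hK hKδ
    (Metric.ball_subset_ball (by linarith) hi')
  have hz : ‖φ (TriPlane.vertex T i)‖ < r := by
    have := hφr ⟨_, TriPlane.vertex_mem_carrier_iff.2 hi, rfl⟩
    rwa [mem_ball_zero_iff] at this
  rw [mem_ball_zero_iff] at hi'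
  have hz' := norm_nonneg (φ' (TriPlane.vertex T i))
  have hN' : 5 / 16 * r' ^ 2 ≤ (3 / 4 * r') ^ 2 - ‖φ' (TriPlane.vertex T i)‖ ^ 2 := by nlinarith
  have hN'0 : 0 < 5 / 16 * r' ^ 2 := by positivity
  rw [TriPlane.hypFactor, le_div_iff₀ (hN'0.trans_le hN')] at hW
  have h1 : m * (r / (3 / 4 * r')) * (5 / 16 * r' ^ 2) ≤ Real.exp (u i) * (K * r) ^ 2 :=
    (mul_le_mul_of_nonneg_left hN' (by positivity)).trans (hW.trans
      (mul_le_mul_of_nonneg_left (by linarith [sq_nonneg ‖φ (TriPlane.vertex T i)‖])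
        (Real.exp_pos _).le))
  have h2 : 5 * m / (12 * K ^ 2) * (r' / r) ≤ Real.exp (u i) := by
    refine le_of_mul_le_mul_right ?_ (by positivity : 0 < (K * r) ^ 2)
    refine Eq.trans_le ?_ h1
    field_simp
    norm_num
  have h3 := Real.log_le_log (by positivity) h2
  rw [Real.log_exp, Real.log_mul (by positivity) (by positivity)] at h3
  have := le_max_right 1 (-Real.log (5 * m / (12 * K ^ 2)))
  linarith
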